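/- Let $N\ge 2$ and let $\Omega\subseteq\mathbb{R}^N$ be a bounded domain with Lipschitz boundary. Let $p,q\in C(\overline\Omega)$ satisfy $1<p(x)<N$ and $p(x)<q(x)$ for all $x\in\overline\Omega$, and let $0\le\mu\in L^1(\Omega)$. Put $$\mathcal{H}(x,t)=t^{p(x)}+\mu(x)\,t^{q(x)}\quad (x\in\Omega,\ t\ge 0),\qquad \rho_{\mathcal H}(u)=\int_\Omega \mathcal{H}(x,|u(x)|)\,dx .$$ Let $L^{\mathcal H}(\Omega)$ be the space of measurable functions $u:\Omega\to\mathbb{R}$ (modulo equality almost everywhere) such that $\rho_{\mathcal H}(\alpha u)<\infty$ for some $\alpha>0$ (equivalently, $\rho_{\mathcal H}(u)<\infty$), with the Luxemburg norm $\|u\|_{\mathcal H}=\inf\{\tau>0:\rho_{\mathcal H}(u/\tau)\le 1\}$. Let $W^{1,\mathcal H}(\Omega)$ be the space of all $u\in L^{\mathcal H}(\Omega)$ having a weak gradient $\nabla u$ with $|\nabla u|\in L^{\mathcal H}(\Omega)$, with the norm $\|u\|_{1,\mathcal H}=\|u\|_{\mathcal H}+\|\,|\nabla u|\,\|_{\mathcal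 H}$, and let $W^{1,\mathcal H}_0(\Omega)$ be the closure of $C_c^\infty(\Omega)$ in $W^{1,\mathcal H}(\Omega)$. Then the norm $\|\cdot\|_{\mathcal H}$ on $L^{\mathcal H}(\Omega)$ is uniformly convex, and the spaces $L^{\mathcal H}(\Omega)$, $W^{1,\mathcal H}(\Omega)$ and $W^{1,\mathcal H}_0(\Omega)$ are reflexive Banach spaces. Furthermore, if $u\in L^{\mathcal H}(\Omega)$ and $(u_n)_{n\in\mathbb N}$ is a sequence in $L^{\mathcal H}(\Omega)$ such that $u_n\rightharpoonup u$ weakly in $L^{\mathcal H}(\Omega)$ and $\rho_{\mathcal H}(u_n)\to\rho_{\mathcal H}(u)$, then $u_n\to u$ in $L^{\mathcal H}(\Omega)$. -/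

import Mathlib

open MeasureTheory Filter Topology
open scoped ENNReal Distributions

namespace DoublePhase

/-! ### Generalized `Φ`-functions and Musielak-Orlicz spaces -/

/-- `f : [0,∞) → [0,∞)` is a `Φ`-function: continuous, convex, `f 0 = 0` and `f t > 0` for `t > 0`.
Only the values of `f` on `[0,∞)` matter. -/
structure IsPhi (f : ℝ → ℝ) : Prop where
  continuousOn : ContinuousOn f (Set.Ici 0)
  convexOn : ConvexOn ℝ (Set.Ici 0) f
  map_zero : f 0 = 0
  pos : ∀ t, 0 < t → 0 < f t

/-- Generalized `Φ`-functions on the open set `Ω ⊆ ℝ^N`: `φ(·, t)` is (Lebesgue) measurable for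
all `t ≥ 0`, and `φ(x, ·)` is a `Φ`-function for a.a. `x ∈ Ω`. -/
structure GenPhi {N : ℕ} (Ω : TopologicalSpace.Opens (EuclideanSpace ℝ (Fin N))) where
  toFun : EuclideanSpace ℝ (Fin N) → ℝ → ℝ
  aemeasurable : ∀ t, 0 ≤ t → AEMeasurable (fun x => toFun x t) (volume.restrict Ω)
  ae_isPhi : ∀ᵐ x ∂(volume.restrict Ω), IsPhi (toFun x)

namespace IsPhi

theorem nonneg {f : ℝ → ℝ} (hf : IsPhi f) {t : ℝ} (ht : 0 ≤ t) : 0 ≤ f t := by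
  rcases ht.eq_or_lt with rfl | h
  · exact hf.map_zero.ge
  · exact (hf.pos t h).le

theorem le_comb {f : ℝ → ℝ} (hf : IsPhi f) {a b s t r : ℝ} (ha : 0 ≤ a) (hb : 0 ≤ b)
    (hab : a + b ≤ 1) (hr : 0 ≤ r) (hs : 0 ≤ s) (ht : 0 ≤ t) (h : r ≤ a * s + b * t) :
    f r ≤ a * f s + b * f t := by
  have scale : ∀ {c u : ℝ}, 0 ≤ c → c ≤ 1 → 0 ≤ u → f (c * u) ≤ c * f u := by
    intro c u hc hc1 hu
    have := hf.convexOn.2 (x := u) (y := 0) hu (by simp) hc (sub_nonneg.2 hc1) (by ring)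
    simpa [hf.map_zero] using this
  have mono : ∀ {u v : ℝ}, 0 ≤ u → u ≤ v → f u ≤ f v := by
    intro u v hu huv
    rcases hu.eq_or_lt with rfl | hu
    · rw [hf.map_zero]; exact hf.nonneg huv
    have hv : 0 < v := hu.trans_le huv
    have h1 : u / v ≤ 1 := (div_le_one hv).2 huv
    have := scale (c := u / v) (by positivity) h1 hv.le
    rw [div_mul_cancel₀ _ hv.ne'] at this
    nlinarith [hf.nonneg hv.le]
  refine (mono hr h).trans ?_
  rcases (add_nonneg ha hb).eq_or_lt with h0 | h0
  · have ha0 : a = 0 := by linarith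
    have hb0 : b = 0 := by linarith
    simp [ha0, hb0, hf.map_zero]
  have hconv := hf.convexOn.2 (x := s) (y := t) hs ht (div_nonneg ha h0.le) (div_nonneg hb h0.le)
    (by field_simp)
  simp only [smul_eq_mul] at hconv
  have hsc := scale (c := a + b) (u := a / (a + b) * s + b / (a + b) * t) h0.le hab (by positivity)
  have e1 : (a + b) * (a / (a + b) * s + b / (a + b) * t) = a * s + b * t := by field_simp
  rw [e1] at hsc
  refine hsc.trans ((mul_le_mul_of_nonneg_left hconv h0.le).trans_eq ?_)
  field_simp

end IsPhi

namespace GenPhi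

variable {N : ℕ} {Ω : TopologicalSpace.Opens (EuclideanSpace ℝ (Fin N))} (φ : GenPhi Ω)
  {F : Type*} [NormedAddCommGroup F] [NormedSpace ℝ F]

/-- The modular `ρ_φ(f) = ∫_Ω φ(x, |f(x)|) dx ∈ [0,∞]`. -/
noncomputable def modular (f : EuclideanSpace ℝ (Fin N) → F) : ℝ≥0∞ :=
  ∫⁻ x in (Ω : Set (EuclideanSpace ℝ (Fin N))), ENNReal.ofReal (φ.toFun x ‖f x‖)

/-- The Luxemburg norm `‖f‖_φ = inf {τ > 0 : ρ_φ(f / τ) ≤ 1}`. -/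
noncomputable def luxemburg (f : EuclideanSpace ℝ (Fin N) → F) : ℝ :=
  sInf {τ : ℝ | 0 < τ ∧ φ.modular (fun x => τ⁻¹ • f x) ≤ 1}

theorem aemeasurable_comp {f : EuclideanSpace ℝ (Fin N) → F}
    (hf : AEStronglyMeasurable f (volume.restrict Ω)) :
    AEMeasurable (fun x => φ.toFun x ‖f x‖) (volume.restrict Ω) := by
  -- approximate `‖f‖` by nonnegative simple functions and use continuity in the second variable
  have hn : AEStronglyMeasurable (fun x => ‖f x‖) (volume.restrict Ω) := hf.norm
  set g := hn.mk _ with hg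
  have hgs : StronglyMeasurable g := hn.stronglyMeasurable_mk
  set s : ℕ → EuclideanSpace ℝ (Fin N) → ℝ := fun n x => |hgs.approx n x| with hs
  have hlim : ∀ᵐ x ∂(volume.restrict (Ω : Set (EuclideanSpace ℝ (Fin N)))),
      Tendsto (fun n => φ.toFun x (s n x)) atTop (𝓝 (φ.toFun x ‖f x‖)) := by
    filter_upwards [φ.ae_isPhi, hn.ae_eq_mk] with x hx hfx
    have h1 : Tendsto (fun n => s n x) atTop (𝓝 ‖f x‖) := by
      have := (hgs.tendsto_approx x).abs
      have e : |g x| = ‖f x‖ := by rw [hg, ← hfx, abs_norm]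
      rwa [e] at this
    have h2 : Tendsto (fun n => s n x) atTop (𝓝[Set.Ici 0] ‖f x‖) :=
      tendsto_nhdsWithin_iff.2 ⟨h1, Eventually.of_forall fun n => Set.mem_Ici.2 (abs_nonneg _)⟩
    exact (hx.continuousOn ‖f x‖ (norm_nonneg _)).tendsto.comp h2
  refine aemeasurable_of_tendsto_metrizable_ae atTop (fun n => ?_) hlim
  refine ⟨fun x => (φ.aemeasurable |hgs.approx n x| (abs_nonneg _)).mk _ x, ?_, ?_⟩
  · exact (hgs.approx n).measurable_bind
      (fun b x => (φ.aemeasurable |b| (abs_nonneg _)).mk _ x)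
      (fun b => (φ.aemeasurable |b| (abs_nonneg _)).measurable_mk)
  · have : ∀ᵐ x ∂(volume.restrict (Ω : Set (EuclideanSpace ℝ (Fin N)))),
        ∀ b ∈ (hgs.approx n).range, φ.toFun x |b| =
          (φ.aemeasurable |b| (abs_nonneg _)).mk _ x :=
      (ae_ball_iff (Finset.countable_toSet _)).2 fun b _ =>
        (φ.aemeasurable |b| (abs_nonneg _)).ae_eq_mk
    filter_upwards [this] with x hx
    exact hx _ (SimpleFunc.mem_range_self _ _)

theorem modular_le_comb {f g h : EuclideanSpace ℝ (Fin N) → F}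
    (hg : AEStronglyMeasurable g (volume.restrict Ω))
    (hh : AEStronglyMeasurable h (volume.restrict Ω))
    {a b : ℝ} (ha : 0 ≤ a) (hb : 0 ≤ b) (hab : a + b ≤ 1)
    (hle : ∀ᵐ x ∂(volume.restrict (Ω : Set (EuclideanSpace ℝ (Fin N)))),
      ‖f x‖ ≤ a * ‖g x‖ + b * ‖h x‖) :
    φ.modular f ≤ ENNReal.ofReal a * φ.modular g + ENNReal.ofReal b * φ.modular h := by
  have mg := (φ.aemeasurable_comp hg).ennreal_ofReal
  have mh := (φ.aemeasurable_comp hh).ennreal_ofReal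
  unfold modular
  rw [← lintegral_const_mul'' _ mg, ← lintegral_const_mul'' _ mh,
    ← lintegral_add_left' (mg.const_mul _)]
  refine lintegral_mono_ae ?_
  filter_upwards [hle, φ.ae_isPhi] with x hx hphi
  rw [← ENNReal.ofReal_mul ha, ← ENNReal.ofReal_mul hb,
    ← ENNReal.ofReal_add (mul_nonneg ha (hphi.nonneg (norm_nonneg _)))
      (mul_nonneg hb (hphi.nonneg (norm_nonneg _)))]
  exact ENNReal.ofReal_le_ofReal
    (hphi.le_comb ha hb hab (norm_nonneg _) (norm_nonneg _) (norm_nonneg _) hx)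

theorem modular_le_mul {f g : EuclideanSpace ℝ (Fin N) → F}
    (hg : AEStronglyMeasurable g (volume.restrict Ω))
    {a : ℝ} (ha : 0 ≤ a) (ha1 : a ≤ 1)
    (hle : ∀ᵐ x ∂(volume.restrict (Ω : Set (EuclideanSpace ℝ (Fin N)))), ‖f x‖ ≤ a * ‖g x‖) :
    φ.modular f ≤ ENNReal.ofReal a * φ.modular g := by
  simpa using φ.modular_le_comb hg hg ha le_rfl (by simpa using ha1) (by simpa using hle)

variable (F) in
/-- The Musielak-Orlicz space `L^φ(Ω; F)` of (classes of a.e. equal) measurable functions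
`u : Ω → F` with `ρ_φ(α u) < ∞` for some `α > 0`. -/
noncomputable def space : Submodule ℝ
    (EuclideanSpace ℝ (Fin N) →ₘ[volume.restrict (Ω : Set (EuclideanSpace ℝ (Fin N)))] F) where
  carrier := {u | ∃ α : ℝ, 0 < α ∧ φ.modular (fun x => α • u x) < ∞}
  zero_mem' := by
    refine ⟨1, one_pos, ?_⟩
    have : φ.modular (fun x => (1 : ℝ) • (0 : EuclideanSpace ℝ (Fin N)
        →ₘ[volume.restrict (Ω : Set (EuclideanSpace ℝ (Fin N)))] F) x) = 0 := by
      unfold modular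
      rw [← lintegral_zero (μ := volume.restrict (Ω : Set (EuclideanSpace ℝ (Fin N))))]
      refine lintegral_congr_ae ?_
      filter_upwards [AEEqFun.coeFn_zero (β := F)
        (μ := volume.restrict (Ω : Set (EuclideanSpace ℝ (Fin N)))), φ.ae_isPhi] with x hx hp
      simp [hx, hp.map_zero]
    rw [this]; exact ENNReal.zero_lt_top
  add_mem' := by
    rintro u v ⟨α, hα, hu⟩ ⟨β, hβ, hv⟩
    refine ⟨min α β / 2, by positivity, ?_⟩
    refine (φ.modular_le_comb (a := 1 / 2) (b := 1 / 2)
      (u.aestronglyMeasurable.const_smul α)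
      (v.aestronglyMeasurable.const_smul β) (by norm_num) (by norm_num) (by norm_num) ?_).trans_lt
      (ENNReal.add_lt_top.2 ⟨ENNReal.mul_lt_top ENNReal.ofReal_lt_top hu,
        ENNReal.mul_lt_top ENNReal.ofReal_lt_top hv⟩)
    filter_upwards [AEEqFun.coeFn_add u v] with x hx
    have hm : 0 < min α β := lt_min hα hβ
    simp only [hx, Pi.add_apply, Pi.smul_apply, norm_smul, Real.norm_eq_abs]
    rw [abs_of_pos (by positivity), abs_of_pos hα, abs_of_pos hβ]
    have h1 := norm_add_le (u x) (v x)
    have h2 := mul_le_mul_of_nonneg_right (min_le_left α β) (norm_nonneg (u x))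
    have h3 := mul_le_mul_of_nonneg_right (min_le_right α β) (norm_nonneg (v x))
    have h4 := mul_le_mul_of_nonneg_left h1 hm.le
    linarith
  smul_mem' := by
    rintro c u ⟨α, hα, hu⟩
    have hc : 0 < |c| + 1 := by positivity
    refine ⟨α / (|c| + 1), by positivity, ?_⟩
    refine (φ.modular_le_mul (a := 1) (u.aestronglyMeasurable.const_smul α)
      zero_le_one le_rfl ?_).trans_lt (ENNReal.mul_lt_top ENNReal.ofReal_lt_top hu)
    filter_upwards [AEEqFun.coeFn_smul c u] with x hx
    simp only [hx, Pi.smul_apply, norm_smul, Real.norm_eq_abs]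
    rw [abs_of_pos (by positivity), abs_of_pos hα, one_mul, ← mul_assoc]
    refine mul_le_mul_of_nonneg_right ?_ (norm_nonneg _)
    rw [div_mul_eq_mul_div, div_le_iff₀ hc]
    nlinarith [abs_nonneg c]

variable {φ}

theorem luxemburg_nonneg (f : EuclideanSpace ℝ (Fin N) → F) : 0 ≤ φ.luxemburg f :=
  Real.sInf_nonneg fun _ h => h.1.le

theorem luxemburg_le {f : EuclideanSpace ℝ (Fin N) → F} {τ : ℝ} (hτ : 0 < τ)
    (h : φ.modular (fun x => τ⁻¹ • f x) ≤ 1) : φ.luxemburg f ≤ τ :=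
  csInf_le ⟨0, fun _ h => h.1.le⟩ ⟨hτ, h⟩

theorem exists_modular_le (u : φ.space F) :
    {τ : ℝ | 0 < τ ∧ φ.modular (fun x => τ⁻¹ • u.1 x) ≤ 1}.Nonempty := by
  obtain ⟨α, hα, hu⟩ := u.2
  set M := (φ.modular (fun x => α • u.1 x)).toReal with hM
  have hM0 : 0 ≤ M := ENNReal.toReal_nonneg
  have hM1 : 0 < M + 1 := by positivity
  refine ⟨(M + 1) / α, by positivity, ?_⟩
  refine (φ.modular_le_mul (a := (M + 1)⁻¹) (u.1.aestronglyMeasurable.const_smul α)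
      (by positivity) (inv_le_one_of_one_le₀ (by linarith)) ?_).trans ?_
  · refine Eventually.of_forall fun x => ?_
    simp only [Pi.smul_apply, norm_smul, Real.norm_eq_abs]
    rw [abs_of_pos (by positivity), abs_of_pos hα, inv_div, ← mul_assoc]
    refine le_of_eq ?_
    ring
  · have : φ.modular (α • ⇑u.1) = ENNReal.ofReal M := (ENNReal.ofReal_toReal hu.ne).symm
    rw [this, ← ENNReal.ofReal_mul (by positivity), ← ENNReal.ofReal_one]
    apply ENNReal.ofReal_le_ofReal
    rw [inv_mul_le_iff₀ hM1]
    linarith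

theorem exists_lt_of_luxemburg_lt (u : φ.space F) {r : ℝ} (h : φ.luxemburg u.1 < r) :
    ∃ τ, 0 < τ ∧ τ < r ∧ φ.modular (fun x => τ⁻¹ • u.1 x) ≤ 1 := by
  obtain ⟨τ, hτ, hr⟩ := exists_lt_of_csInf_lt (exists_modular_le u) h
  exact ⟨τ, hτ.1, hr, hτ.2⟩

theorem luxemburg_add_le (u v : φ.space F) :
    φ.luxemburg (u + v).1 ≤ φ.luxemburg u.1 + φ.luxemburg v.1 := by
  refine le_of_forall_pos_le_add fun ε hε => ?_
  obtain ⟨α, hα, hα', hu⟩ := exists_lt_of_luxemburg_lt u (lt_add_of_pos_right _ (half_pos hε))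
  obtain ⟨β, hβ, hβ', hv⟩ := exists_lt_of_luxemburg_lt v (lt_add_of_pos_right _ (half_pos hε))
  have hαβ : 0 < α + β := add_pos hα hβ
  have key : φ.luxemburg (u + v).1 ≤ α + β := by
    refine luxemburg_le hαβ ?_
    refine (φ.modular_le_comb (a := α / (α + β)) (b := β / (α + β))
      (u.1.aestronglyMeasurable.const_smul α⁻¹)
      (v.1.aestronglyMeasurable.const_smul β⁻¹) (by positivity) (by positivity)
      (by rw [← add_div, div_self hαβ.ne']) ?_).trans
      ((add_le_add (mul_le_mul_right hu _) (mul_le_mul_right hv _)).trans_eq ?_)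
    · filter_upwards [AEEqFun.coeFn_add u.1 v.1] with x hx
      simp only [Submodule.coe_add, hx, Pi.add_apply, Pi.smul_apply, norm_smul, Real.norm_eq_abs]
      rw [abs_of_pos (by positivity), abs_of_pos (by positivity), abs_of_pos (by positivity)]
      have e1 : α / (α + β) * (α⁻¹ * ‖u.1 x‖) + β / (α + β) * (β⁻¹ * ‖v.1 x‖)
          = (α + β)⁻¹ * (‖u.1 x‖ + ‖v.1 x‖) := by field_simp
      rw [e1]
      exact mul_le_mul_of_nonneg_left (norm_add_le _ _) (by positivity)
    · rw [mul_one, mul_one, ← ENNReal.ofReal_add (by positivity) (by positivity), ← add_div,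
        div_self hαβ.ne', ENNReal.ofReal_one]
  linarith

theorem luxemburg_smul_le (c : ℝ) (u : φ.space F) :
    φ.luxemburg (c • u).1 ≤ |c| * φ.luxemburg u.1 := by
  rcases eq_or_ne c 0 with rfl | hc
  · have h0 : φ.luxemburg (((0 : ℝ) • u).1 : EuclideanSpace ℝ (Fin N) → F) ≤ 0 := by
      refine le_of_forall_pos_le_add fun ε hε => ?_
      rw [zero_add]
      refine luxemburg_le hε ?_
      refine (φ.modular_le_mul (a := 0) u.1.aestronglyMeasurable
        le_rfl zero_le_one ?_).trans (by simp)
      filter_upwards [AEEqFun.coeFn_smul (0 : ℝ) u.1] with x hx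
      simp only [Submodule.coe_smul, hx]
      simp
    simpa using h0
  have hc' : 0 < |c| := abs_pos.2 hc
  refine le_of_forall_pos_le_add fun ε hε => ?_
  obtain ⟨α, hα, hα', hu⟩ := exists_lt_of_luxemburg_lt u
    (lt_add_of_pos_right _ (div_pos hε hc'))
  have key : φ.luxemburg (c • u).1 ≤ |c| * α := by
    refine luxemburg_le (by positivity) ?_
    refine (φ.modular_le_mul (a := 1) (u.1.aestronglyMeasurable.const_smul α⁻¹)
      zero_le_one le_rfl ?_).trans
      (by rw [ENNReal.ofReal_one, one_mul]; exact hu)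
    filter_upwards [AEEqFun.coeFn_smul c u.1] with x hx
    simp only [Submodule.coe_smul, hx, Pi.smul_apply, norm_smul, Real.norm_eq_abs]
    rw [abs_of_pos (inv_pos.2 (mul_pos hc' hα)), abs_of_pos (inv_pos.2 hα)]
    refine le_of_eq ?_
    field_simp
  have : |c| * α ≤ |c| * (φ.luxemburg u.1 + ε / |c|) :=
    mul_le_mul_of_nonneg_left hα'.le hc'.le
  rw [mul_add, mul_div_cancel₀ _ hc'.ne'] at this
  linarith

theorem eq_zero_of_luxemburg_eq_zero (u : φ.space F) (h : φ.luxemburg u.1 = 0) : u = 0 := by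
  have hle : ∀ ε : ℝ, 0 < ε → φ.modular (u.1 : EuclideanSpace ℝ (Fin N) → F)
      ≤ ENNReal.ofReal ε := by
    intro ε hε
    obtain ⟨τ, hτ, hτ', hu⟩ := exists_lt_of_luxemburg_lt u (r := min ε 1)
      (by rw [h]; exact lt_min hε one_pos)
    refine (φ.modular_le_mul (a := τ) (u.1.aestronglyMeasurable.const_smul τ⁻¹) hτ.le
      (hτ'.le.trans (min_le_right _ _)) ?_).trans ((mul_le_mul_right hu _).trans ?_)
    · refine Eventually.of_forall fun x => ?_
      simp only [Pi.smul_apply, norm_smul, Real.norm_eq_abs]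
      rw [abs_of_pos (by positivity), mul_inv_cancel_left₀ hτ.ne']
    · rw [mul_one]
      exact ENNReal.ofReal_le_ofReal (hτ'.le.trans (min_le_left _ _))
  have h0 : φ.modular (u.1 : EuclideanSpace ℝ (Fin N) → F) = 0 := by
    refine le_antisymm (ENNReal.le_of_forall_pos_le_add fun ε hε _ => ?_) zero_le
    simpa using hle ε hε
  have h1 := (lintegral_eq_zero_iff'
    (φ.aemeasurable_comp u.1.aestronglyMeasurable).ennreal_ofReal).1 h0
  refine Subtype.ext (AEEqFun.ext ?_)
  filter_upwards [h1, φ.ae_isPhi, AEEqFun.coeFn_zero (β := F)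
    (μ := volume.restrict (Ω : Set (EuclideanSpace ℝ (Fin N))))] with x hx hp h0x
  rw [Submodule.coe_zero, h0x]
  by_contra hne
  have hpos := hp.pos ‖u.1 x‖ (norm_pos_iff.2 hne)
  simp only [Pi.zero_apply, ENNReal.ofReal_eq_zero] at hx
  linarith

/-- `L^φ(Ω; F)` is equipped with the Luxemburg norm. -/
noncomputable instance instNormedAddCommGroupSpace : NormedAddCommGroup (φ.space F) :=
  AddGroupNorm.toNormedAddCommGroup
    { toFun := fun u => φ.luxemburg u.1
      map_zero' := le_antisymm
        (by simpa using luxemburg_smul_le (0 : ℝ) (0 : φ.space F)) (luxemburg_nonneg _)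
      add_le' := luxemburg_add_le
      neg' := fun u => le_antisymm
        (by simpa using luxemburg_smul_le (-1 : ℝ) u)
        (by simpa using luxemburg_smul_le (-1 : ℝ) (-u))
      eq_zero_of_map_eq_zero' := eq_zero_of_luxemburg_eq_zero }

noncomputable instance instNormedSpaceSpace : NormedSpace ℝ (φ.space F) where
  norm_smul_le := luxemburg_smul_le

theorem norm_space_def (u : φ.space F) : ‖u‖ = φ.luxemburg u.1 := rfl

end GenPhi

/-! ### Weak gradients and Musielak-Orlicz Sobolev spaces -/

section WeakGradient

variable {N : ℕ} {Ω : TopologicalSpace.Opens (EuclideanSpace ℝ (Fin N))}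

variable (Ω) in
/-- `g = ∇u` weakly in `Ω`: both are locally integrable in `Ω` and
`∫_Ω u ∇ψ dx = - ∫_Ω ψ g dx` for all `ψ ∈ C_c^∞(Ω)`. -/
structure IsWeakGradient (u : EuclideanSpace ℝ (Fin N) → ℝ)
    (g : EuclideanSpace ℝ (Fin N) → EuclideanSpace ℝ (Fin N)) : Prop where
  locallyIntegrableOn : LocallyIntegrableOn u Ω
  locallyIntegrableOn_grad : LocallyIntegrableOn g Ω
  integral_eq : ∀ ψ : 𝓓(Ω, ℝ),
    ∫ x in (Ω : Set (EuclideanSpace ℝ (Fin N))), u x • gradient ψ x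
      = - ∫ x in (Ω : Set (EuclideanSpace ℝ (Fin N))), ψ x • g x

theorem integrable_test_smul {g : EuclideanSpace ℝ (Fin N) → EuclideanSpace ℝ (Fin N)}
    (hg : LocallyIntegrableOn g (Ω : Set (EuclideanSpace ℝ (Fin N)))) (ψ : 𝓓(Ω, ℝ)) :
    IntegrableOn (fun x => ψ x • g x) (Ω : Set (EuclideanSpace ℝ (Fin N))) := by
  have h1 : IntegrableOn (fun x => ψ x • g x) (tsupport ψ) :=
    (hg.integrableOn_compact_subset ψ.tsupport_subset ψ.hasCompactSupport).continuousOn_smul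
      ψ.continuous.continuousOn ψ.hasCompactSupport
  refine ((integrableOn_iff_integrable_of_support_subset ?_).1 h1).integrableOn
  intro x hx
  by_contra hn
  exact hx (by simp [image_eq_zero_of_notMem_tsupport hn])

theorem integrable_smul_grad_test {u : EuclideanSpace ℝ (Fin N) → ℝ}
    (hu : LocallyIntegrableOn u (Ω : Set (EuclideanSpace ℝ (Fin N)))) (ψ : 𝓓(Ω, ℝ)) :
    IntegrableOn (fun x => u x • gradient ψ x) (Ω : Set (EuclideanSpace ℝ (Fin N))) := by
  have hc : Continuous (gradient (ψ : EuclideanSpace ℝ (Fin N) → ℝ)) :=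
    (LinearIsometryEquiv.continuous _).comp (ψ.contDiff.continuous_fderiv (by simp))
  have h1 : IntegrableOn (fun x => u x • gradient ψ x) (tsupport ψ) :=
    (hu.integrableOn_compact_subset ψ.tsupport_subset ψ.hasCompactSupport).smul_continuousOn
      hc.continuousOn ψ.hasCompactSupport
  refine ((integrableOn_iff_integrable_of_support_subset ?_).1 h1).integrableOn
  intro x hx
  by_contra hn
  refine hx ?_
  have : fderiv ℝ (ψ : EuclideanSpace ℝ (Fin N) → ℝ) x = 0 :=
    image_eq_zero_of_notMem_tsupport (fun h => hn (tsupport_fderiv_subset ℝ h))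
  simp [gradient, this]

namespace IsWeakGradient

variable {u v : EuclideanSpace ℝ (Fin N) → ℝ}
  {g h : EuclideanSpace ℝ (Fin N) → EuclideanSpace ℝ (Fin N)}

theorem congr (hu : IsWeakGradient Ω u g) (huv : u =ᵐ[volume.restrict Ω] v)
    (hgh : g =ᵐ[volume.restrict Ω] h) : IsWeakGradient Ω v h where
  locallyIntegrableOn := hu.locallyIntegrableOn.congr huv
  locallyIntegrableOn_grad := hu.locallyIntegrableOn_grad.congr hgh
  integral_eq ψ := by
    have e1 : ∫ x in (Ω : Set (EuclideanSpace ℝ (Fin N))), u x • gradient ψ x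
        = ∫ x in (Ω : Set (EuclideanSpace ℝ (Fin N))), v x • gradient ψ x :=
      integral_congr_ae (huv.mono fun x hx => congrArg (· • gradient ψ x) hx)
    have e2 : ∫ x in (Ω : Set (EuclideanSpace ℝ (Fin N))), ψ x • g x
        = ∫ x in (Ω : Set (EuclideanSpace ℝ (Fin N))), ψ x • h x :=
      integral_congr_ae (hgh.mono fun x hx => congrArg (ψ x • ·) hx)
    rw [← e1, ← e2, hu.integral_eq ψ]

theorem add (hu : IsWeakGradient Ω u g) (hv : IsWeakGradient Ω v h) :
    IsWeakGradient Ω (u + v) (g + h) where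
  locallyIntegrableOn := hu.locallyIntegrableOn.add hv.locallyIntegrableOn
  locallyIntegrableOn_grad := hu.locallyIntegrableOn_grad.add hv.locallyIntegrableOn_grad
  integral_eq ψ := by
    simp only [Pi.add_apply, add_smul, smul_add]
    rw [integral_add (integrable_smul_grad_test hu.locallyIntegrableOn ψ)
      (integrable_smul_grad_test hv.locallyIntegrableOn ψ),
      integral_add (integrable_test_smul hu.locallyIntegrableOn_grad ψ)
      (integrable_test_smul hv.locallyIntegrableOn_grad ψ), hu.integral_eq, hv.integral_eq, neg_add]

theorem smul (c : ℝ) (hu : IsWeakGradient Ω u g) : IsWeakGradient Ω (c • u) (c • g) where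
  locallyIntegrableOn := hu.locallyIntegrableOn.smul c
  locallyIntegrableOn_grad := hu.locallyIntegrableOn_grad.smul c
  integral_eq ψ := by
    simp only [Pi.smul_apply, smul_assoc, smul_comm _ c]
    rw [integral_smul, integral_smul, hu.integral_eq, smul_neg]

theorem ae_eq (hg : IsWeakGradient Ω u g) (hh : IsWeakGradient Ω u h) :
    g =ᵐ[volume.restrict Ω] h := by
  have key := Ω.isOpen.ae_eq_zero_of_integral_contDiff_smul_eq_zero
    (hg.locallyIntegrableOn_grad.sub hh.locallyIntegrableOn_grad) (fun ψ h1 h2 h3 => by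
      have e := (hg.integral_eq ⟨ψ, h1, h2, h3⟩).symm.trans (hh.integral_eq ⟨ψ, h1, h2, h3⟩)
      have i1 := integrable_test_smul hg.locallyIntegrableOn_grad ⟨ψ, h1, h2, h3⟩
      have i2 := integrable_test_smul hh.locallyIntegrableOn_grad ⟨ψ, h1, h2, h3⟩
      rw [← setIntegral_eq_integral_of_forall_compl_eq_zero
        (s := (Ω : Set (EuclideanSpace ℝ (Fin N))))]
      · simp only [Pi.sub_apply, smul_sub]
        exact (integral_sub i1 i2).trans (sub_eq_zero.2 (neg_injective e))
      · intro x hx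
        rw [image_eq_zero_of_notMem_tsupport (fun h => hx (h3 h)), zero_smul])
  rw [Filter.EventuallyEq, ae_restrict_iff' Ω.isOpen.measurableSet]
  filter_upwards [key] with x hx hxΩ
  exact sub_eq_zero.1 (hx hxΩ)

end IsWeakGradient

end WeakGradient

namespace GenPhi

variable {N : ℕ} {Ω : TopologicalSpace.Opens (EuclideanSpace ℝ (Fin N))} (φ : GenPhi Ω)

/-- The Musielak-Orlicz Sobolev space `W^{1,φ}(Ω) = {u ∈ L^φ(Ω) : |∇u| ∈ L^φ(Ω)}`, where `∇u` is
the weak gradient. -/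
noncomputable def sobolev : Submodule ℝ
    (EuclideanSpace ℝ (Fin N) →ₘ[volume.restrict (Ω : Set (EuclideanSpace ℝ (Fin N)))] ℝ) where
  carrier := {u | u ∈ φ.space ℝ ∧
    ∃ g ∈ φ.space (EuclideanSpace ℝ (Fin N)), IsWeakGradient Ω u g}
  zero_mem' := by
    refine ⟨zero_mem _, 0, zero_mem _, ?_⟩
    have : IsWeakGradient Ω (0 : EuclideanSpace ℝ (Fin N) → ℝ) 0 :=
      ⟨locallyIntegrableOn_zero, locallyIntegrableOn_zero, fun ψ => by simp⟩
    exact this.congr AEEqFun.coeFn_zero.symm AEEqFun.coeFn_zero.symm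
  add_mem' := by
    rintro u v ⟨hu, g, hg, hug⟩ ⟨hv, h, hh, hvh⟩
    exact ⟨add_mem hu hv, g + h, add_mem hg hh, (hug.add hvh).congr
      (AEEqFun.coeFn_add u v).symm (AEEqFun.coeFn_add g h).symm⟩
  smul_mem' := by
    rintro c u ⟨hu, g, hg, hug⟩
    exact ⟨Submodule.smul_mem _ c hu, c • g, Submodule.smul_mem _ c hg, (hug.smul c).congr
      (AEEqFun.coeFn_smul c u).symm (AEEqFun.coeFn_smul c g).symm⟩

variable {φ}

/-- The inclusion `W^{1,φ}(Ω) ⊆ L^φ(Ω)`. -/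
def sobolevVal (u : φ.sobolev) : φ.space ℝ := ⟨u.1, u.2.1⟩

/-- The weak gradient `∇u ∈ L^φ(Ω; ℝ^N)` of `u ∈ W^{1,φ}(Ω)` (unique by
`IsWeakGradient.ae_eq`). -/
noncomputable def weakGrad (u : φ.sobolev) : φ.space (EuclideanSpace ℝ (Fin N)) :=
  ⟨u.2.2.choose, u.2.2.choose_spec.1⟩

theorem isWeakGradient_weakGrad (u : φ.sobolev) : IsWeakGradient Ω u.1 (weakGrad u).1 :=
  u.2.2.choose_spec.2

theorem weakGrad_eq (u : φ.sobolev) (g : φ.space (EuclideanSpace ℝ (Fin N)))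
    (h : IsWeakGradient Ω u.1 g.1) : weakGrad u = g :=
  Subtype.ext (AEEqFun.ext ((isWeakGradient_weakGrad u).ae_eq h))

theorem weakGrad_add (u v : φ.sobolev) : weakGrad (u + v) = weakGrad u + weakGrad v :=
  weakGrad_eq _ _ (((isWeakGradient_weakGrad u).add (isWeakGradient_weakGrad v)).congr
    (AEEqFun.coeFn_add _ _).symm (AEEqFun.coeFn_add _ _).symm)

theorem weakGrad_smul (c : ℝ) (u : φ.sobolev) : weakGrad (c • u) = c • weakGrad u :=
  weakGrad_eq _ _ (((isWeakGradient_weakGrad u).smul c).congr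
    (AEEqFun.coeFn_smul _ _).symm (AEEqFun.coeFn_smul _ _).symm)

/-- `W^{1,φ}(Ω)` is equipped with the norm `‖u‖_{1,φ} = ‖u‖_φ + ‖∇u‖_φ`. -/
noncomputable instance instNormedAddCommGroupSobolev : NormedAddCommGroup φ.sobolev :=
  AddGroupNorm.toNormedAddCommGroup
    { toFun := fun u => ‖sobolevVal u‖ + ‖weakGrad u‖
      map_zero' := by
        have h1 : weakGrad (0 : φ.sobolev) = 0 := by
          simpa using weakGrad_smul (0 : ℝ) (0 : φ.sobolev)
        have h2 : sobolevVal (0 : φ.sobolev) = 0 := rfl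
        rw [h1, h2, norm_zero, norm_zero, add_zero]
      add_le' := fun u v => by
        have h2 : sobolevVal (u + v) = sobolevVal u + sobolevVal v := rfl
        rw [weakGrad_add, h2]
        linarith [norm_add_le (sobolevVal u) (sobolevVal v), norm_add_le (weakGrad u) (weakGrad v)]
      neg' := fun u => by
        have h1 : weakGrad (-u) = - weakGrad u := by
          rw [← neg_one_smul ℝ u, weakGrad_smul, neg_one_smul]
        have h2 : sobolevVal (-u) = - sobolevVal u := rfl
        rw [h1, h2, norm_neg, norm_neg]
      eq_zero_of_map_eq_zero' := fun u hu => by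
        have h1 : ‖sobolevVal u‖ = 0 := by
          linarith [norm_nonneg (sobolevVal u), norm_nonneg (weakGrad u)]
        have h2 : sobolevVal u = 0 := norm_eq_zero.1 h1
        exact Subtype.ext (congrArg (fun v : φ.space ℝ => v.1) h2) }

theorem norm_sobolev_def (u : φ.sobolev) : ‖u‖ = ‖sobolevVal u‖ + ‖weakGrad u‖ := rfl

noncomputable instance instNormedSpaceSobolev : NormedSpace ℝ φ.sobolev where
  norm_smul_le c u := by
    have h2 : sobolevVal (c • u) = c • sobolevVal u := rfl
    rw [norm_sobolev_def, norm_sobolev_def, weakGrad_smul, h2, norm_smul, norm_smul, mul_add]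

variable (φ)

/-- The elements of `W^{1,φ}(Ω)` that are represented by a function in `C_c^∞(Ω)`. -/
noncomputable def testSubmodule : Submodule ℝ φ.sobolev where
  carrier := {u | ∃ ψ : 𝓓(Ω, ℝ), u.1 =ᵐ[volume.restrict Ω] ψ}
  zero_mem' := ⟨0, by
    filter_upwards [AEEqFun.coeFn_zero (β := ℝ)
      (μ := volume.restrict (Ω : Set (EuclideanSpace ℝ (Fin N))))] with x hx
    simpa using hx⟩
  add_mem' := by
    rintro u v ⟨ψ, hψ⟩ ⟨χ, hχ⟩
    refine ⟨ψ + χ, ?_⟩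
    filter_upwards [AEEqFun.coeFn_add u.1 v.1, hψ, hχ] with x hx h1 h2
    simp [hx, h1, h2]
  smul_mem' := by
    rintro c u ⟨ψ, hψ⟩
    refine ⟨c • ψ, ?_⟩
    filter_upwards [AEEqFun.coeFn_smul c u.1, hψ] with x hx h1
    simp [hx, h1]

/-- `W_0^{1,φ}(Ω)`: the closure of `C_c^∞(Ω)` in `W^{1,φ}(Ω)`, with the norm of `W^{1,φ}(Ω)`. -/
noncomputable def sobolevZero : Submodule ℝ φ.sobolev := φ.testSubmodule.topologicalClosure

end GenPhi

/-! ### The double phase function with variable exponents -/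

/-- `Ω` has Lipschitz boundary: near each boundary point, in suitable orthonormal coordinates, `Ω`
is the region strictly above the graph of a Lipschitz function. Here `e` is the vertical unit
vector and `γ` is defined on the orthogonal complement of `e`. -/
def HasLipschitzBoundary {E : Type*} [NormedAddCommGroup E] [InnerProductSpace ℝ E]
    (Ω : Set E) : Prop :=
  ∀ x₀ ∈ frontier Ω, ∃ r : ℝ, 0 < r ∧ ∃ e : E, ‖e‖ = 1 ∧
    ∃ (K : NNReal) (γ : (ℝ ∙ e)ᗮ → ℝ), LipschitzWith K γ ∧
      ∀ x ∈ Metric.ball x₀ r, x ∈ Ω ↔ γ ((ℝ ∙ e)ᗮ.orthogonalProjectionOnto x) < inner ℝ e x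

/-- The standing hypotheses: `Ω ⊆ ℝ^N`, `N ≥ 2`, is a bounded domain with Lipschitz boundary,
`p, q ∈ C(closure Ω)` with `1 < p(x) < N` and `p(x) < q(x)` on the closure of `Ω`, and
`0 ≤ μ ∈ L^1(Ω)`. -/
structure Hypotheses {N : ℕ} (Ω : TopologicalSpace.Opens (EuclideanSpace ℝ (Fin N)))
    (p q μ : EuclideanSpace ℝ (Fin N) → ℝ) : Prop where
  two_le : 2 ≤ N
  isConnected : IsConnected (Ω : Set (EuclideanSpace ℝ (Fin N)))
  isBounded : Bornology.IsBounded (Ω : Set (EuclideanSpace ℝ (Fin N)))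
  lipschitz : HasLipschitzBoundary (Ω : Set (EuclideanSpace ℝ (Fin N)))
  continuousOn_p : ContinuousOn p (closure Ω)
  continuousOn_q : ContinuousOn q (closure Ω)
  one_lt_p : ∀ x ∈ closure (Ω : Set (EuclideanSpace ℝ (Fin N))), 1 < p x
  p_lt_dim : ∀ x ∈ closure (Ω : Set (EuclideanSpace ℝ (Fin N))), p x < N
  p_lt_q : ∀ x ∈ closure (Ω : Set (EuclideanSpace ℝ (Fin N))), p x < q x
  weight_nonneg : ∀ᵐ x ∂(volume.restrict (Ω : Set (EuclideanSpace ℝ (Fin N)))), 0 ≤ μ x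
  weight_integrable : IntegrableOn μ Ω

section

variable {N : ℕ} {Ω : TopologicalSpace.Opens (EuclideanSpace ℝ (Fin N))}
  {p q μ : EuclideanSpace ℝ (Fin N) → ℝ}

/-- The double phase function `H(x,t) = t^{p(x)} + μ(x) t^{q(x)}` as a generalized `Φ`-function. -/
noncomputable def doublePhase (h : Hypotheses Ω p q μ) : GenPhi Ω where
  toFun x t := t ^ p x + μ x * t ^ q x
  aemeasurable t _ := by
    have hp : AEMeasurable p (volume.restrict (Ω : Set (EuclideanSpace ℝ (Fin N)))) :=
      (h.continuousOn_p.mono subset_closure).aemeasurable Ω.isOpen.measurableSet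
    have hq : AEMeasurable q (volume.restrict (Ω : Set (EuclideanSpace ℝ (Fin N)))) :=
      (h.continuousOn_q.mono subset_closure).aemeasurable Ω.isOpen.measurableSet
    exact (hp.const_pow t).add (h.weight_integrable.aemeasurable.mul (hq.const_pow t))
  ae_isPhi := by
    filter_upwards [h.weight_nonneg, ae_restrict_mem Ω.isOpen.measurableSet] with x hμ hx
    have hp := h.one_lt_p x (subset_closure hx)
    have hq := hp.trans (h.p_lt_q x (subset_closure hx))
    have hp0 : 0 < p x := by linarith
    have hq0 : 0 < q x := by linarith
    exact
      { continuousOn := by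
          refine ((Real.continuous_rpow_const hp0.le).add
            ((Real.continuous_rpow_const hq0.le).const_mul _)).continuousOn
        convexOn := (convexOn_rpow hp.le).add ((convexOn_rpow hq.le).smul hμ)
        map_zero := by simp [Real.zero_rpow hp0.ne', Real.zero_rpow hq0.ne']
        pos := fun t ht => add_pos_of_pos_of_nonneg (Real.rpow_pos_of_pos ht _)
          (mul_nonneg hμ (Real.rpow_pos_of_pos ht _).le) }

end

/-- A real normed space is reflexive if the canonical embedding into its bidual is onto. -/
def IsReflexive (X : Type*) [NormedAddCommGroup X] [NormedSpace ℝ X] : Prop :=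
  Function.Surjective (NormedSpace.inclusionInDoubleDual ℝ X)

end DoublePhase

/-!
The whole theorem rests on one inequality for the double phase function `H`: for every `ε > 0` there
is `C > 0` such that for almost all `x` and all vectors `a, b`,

`H(x, |a - b|) + C H(x, |(a + b) / 2|) ≤ (ε + C / 2) (H(x, |a|) + H(x, |b|))`.

It is linear in `H(x, ·)`, so it reduces to powers `t ^ r` with one constant `C` for all exponents
`r` in a compact subinterval of `(1, ∞)` (`exists_rpow_norm_sub_le`, by homogeneity and
compactness); `p` and `q` take values in such an interval because the closure of `Ω` is compact.
Besides this, only the growth bounds `H(x, c t) ≤ c ^ r₁ H(x, t)` for `c ≥ 1` and `t ≤ 1 + H(x, t)`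
are used, and the results are stated for any generalized `Φ`-function with these three properties.

Integrating the inequality shows that `ρ(u - v)` is controlled by the convexity gap
`(ρ(u) + ρ(v)) / 2 - ρ((u + v) / 2)` of the modular.
* With the power growth, which compares modular and norm, this gives uniform convexity of the
  Luxemburg norm (`uniformConvexSpace_space`).
* The modular is weakly lower semicontinuous, because its sublevel sets are convex and closed. If
  `u_n ⇀ v` and `ρ(u_n) → ρ(v)`, the convexity gaps of the pairs `(u_n, v)` therefore tend to zero,
  so that `ρ(u_n - v) → 0` (`tendsto_of_weak_of_modular`).

The lower bound `t ≤ 1 + H(x, t)` embeds `L^H(Ω; F)` into `L^1(Ω; F)`, which gives completeness of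
`L^H` by Fatou's lemma and lets weak gradients pass to limits, so that `W^{1,H}` is complete.
Reflexivity of `L^H(Ω)` and `L^H(Ω; ℝ^N)` is the Milman-Pettis theorem
(`isReflexive_of_uniformConvexSpace`), and it passes to `W^{1,H}` and `W_0^{1,H}` through the
embedding `u ↦ (u, ∇u)` into the product of these two spaces (`IsReflexive.of_antilipschitz`).
-/

namespace DoublePhase

/-! ### Reflexivity -/

section Reflexive

variable {X Y : Type*} [NormedAddCommGroup X] [NormedSpace ℝ X] [NormedAddCommGroup Y]
  [NormedSpace ℝ Y]

/-- Goldstine's theorem for finitely many functionals: an element of the closed unit ball of the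
bidual is approximated on them by an element of the closed unit ball of `X`. -/
theorem goldstine_finite (F : StrongDual ℝ (StrongDual ℝ X)) (hF : ‖F‖ ≤ 1)
    (s : Finset (StrongDual ℝ X)) {ε : ℝ} (hε : 0 < ε) :
    ∃ x : X, ‖x‖ ≤ 1 ∧ ∀ f ∈ s, |f x - F f| < ε := by
  classical
  let T : X →L[ℝ] (s → ℝ) := ContinuousLinearMap.pi fun f => f.1
  let y : s → ℝ := fun f => F f.1
  have hy : y ∈ closure (T '' Metric.closedBall 0 1) := by
    by_contra hn
    obtain ⟨g, c, hg, hgc⟩ := geometric_hahn_banach_closed_point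
      ((convex_closedBall (0 : X) 1).linear_image T.toLinearMap).closure isClosed_closure hn
    -- the separating functional pulls back to `∑ g(e_f) f`, whose norm is then too small
    have hle : ∀ x : X, ‖x‖ ≤ 1 → (g.comp T) x ≤ c := fun x hx =>
      (hg _ (subset_closure ⟨x, by simpa using hx, rfl⟩)).le
    have hnorm : ‖g.comp T‖ ≤ c := by
      have hc : 0 ≤ c := by simpa using hle 0 (by simp)
      refine ContinuousLinearMap.opNorm_le_of_unit_norm hc fun x hx => ?_
      rw [Real.norm_eq_abs, abs_le]
      have h1 := hle x hx.le
      have h2 := hle (-x) (by simp [hx])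
      rw [map_neg] at h2
      exact ⟨by linarith, h1⟩
    have hexp : ∀ z : s → ℝ, g z = ∑ f, z f * g (Pi.single f 1) := fun z => by
      conv_lhs => rw [← Finset.univ_sum_single z]
      rw [map_sum]
      refine Finset.sum_congr rfl fun f _ => ?_
      rw [← smul_eq_mul, ← map_smul, ← Pi.single_smul, smul_eq_mul, mul_one]
    have hcomp : g.comp T = ∑ f : s, g (Pi.single f 1) • f.1 := by
      ext x
      simp only [ContinuousLinearMap.comp_apply, hexp (T x), sum_apply,
        smul_apply, smul_eq_mul]
      exact Finset.sum_congr rfl fun f _ => mul_comm _ _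
    have hFy : g y = F (g.comp T) := by
      rw [hexp, hcomp, map_sum]
      refine Finset.sum_congr rfl fun f _ => ?_
      rw [map_smul, smul_eq_mul, mul_comm]
    have h1 : F (g.comp T) ≤ ‖g.comp T‖ :=
      (le_abs_self _).trans ((F.le_opNorm _).trans (mul_le_of_le_one_left (norm_nonneg _) hF))
    linarith
  obtain ⟨_, ⟨x, hx, rfl⟩, hxy⟩ := Metric.mem_closure_iff.1 hy ε hε
  refine ⟨x, by simpa using hx, fun f hf => ?_⟩
  have := (dist_le_pi_dist y (T x) ⟨f, hf⟩).trans_lt hxy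
  rwa [Real.dist_eq, abs_sub_comm] at this

/-- Goldstine's theorem in filter form: an element of the closed unit ball of the bidual is the
weak-* limit of a filter living on the closed unit ball of `X`. -/
theorem exists_filter_tendsto_bidual (F : StrongDual ℝ (StrongDual ℝ X)) (hF : ‖F‖ ≤ 1) :
    ∃ l : Filter X, l.NeBot ∧ (∀ᶠ x in l, ‖x‖ ≤ 1) ∧
      ∀ f : StrongDual ℝ X, Tendsto f l (𝓝 (F f)) := by
  classical
  choose x hx1 hx using fun i : Finset (StrongDual ℝ X) × ℕ =>
    goldstine_finite F hF i.1 (Nat.one_div_pos_of_nat (α := ℝ) (n := i.2))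
  refine ⟨map x atTop, inferInstance, eventually_map.2 (Eventually.of_forall hx1), fun f => ?_⟩
  rw [tendsto_map'_iff, Metric.tendsto_nhds]
  intro ε hε
  obtain ⟨n, hn⟩ := exists_nat_one_div_lt hε
  filter_upwards [eventually_ge_atTop ({f}, n)] with i hi
  rw [Function.comp_apply, Real.dist_eq]
  exact (hx i f (hi.1 (by simp))).trans_le ((Nat.one_div_le_one_div hi.2).trans hn.le)

theorem norm_inv_norm_smul (x : X) (hx : x ≠ 0) : ‖‖x‖⁻¹ • x‖ = 1 := by
  rw [norm_smul, norm_inv, norm_norm, inv_mul_cancel₀ (norm_ne_zero_iff.2 hx)]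

/-- The Milman-Pettis theorem. By uniform convexity, a filter on the unit ball which converges
weak-* to a norm-one element of the bidual is Cauchy in norm. -/
theorem isReflexive_of_uniformConvexSpace [UniformConvexSpace X] [CompleteSpace X] :
    IsReflexive X := by
  have key : ∀ F : StrongDual ℝ (StrongDual ℝ X), ‖F‖ = 1 →
      ∃ x, NormedSpace.inclusionInDoubleDual ℝ X x = F := by
    intro F hF
    obtain ⟨l, hl, hl1, hlF⟩ := exists_filter_tendsto_bidual F hF.le
    have hC : Cauchy l := by
      refine Metric.cauchy_iff.2 ⟨hl, fun ε hε => ?_⟩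
      obtain ⟨δ, hδ, h⟩ := exists_forall_closed_ball_dist_add_le_two_sub X hε
      -- a functional of norm `≤ 1` almost attaining `‖F‖` forces midpoints to have norm near `1`
      obtain ⟨f, hf, hFf⟩ : ∃ f : StrongDual ℝ X, ‖f‖ ≤ 1 ∧ 1 - δ / 2 < F f := by
        by_contra! hn
        have hb : ‖F‖ ≤ max (1 - δ / 2) 0 := by
          refine ContinuousLinearMap.opNorm_le_of_unit_norm (le_max_right _ _) fun f hf => ?_
          rw [Real.norm_eq_abs, abs_le]
          have h1 := hn f hf.le
          have h2 := hn (-f) (by simp [hf])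
          rw [map_neg] at h2
          have h3 := le_max_left (1 - δ / 2) 0
          exact ⟨by linarith, by linarith⟩
        rw [hF] at hb
        rcases le_max_iff.1 hb with h | h <;> linarith
      refine ⟨_, inter_mem hl1 ((hlF f).eventually (lt_mem_nhds hFf)), ?_⟩
      rintro x ⟨hx1, hx2⟩ y ⟨hy1, hy2⟩
      rw [dist_eq_norm]
      by_contra! hxy
      have h1 := h hx1 hy1 hxy
      have h2 : f (x + y) ≤ ‖x + y‖ := (le_abs_self _).trans
        ((f.le_opNorm _).trans (mul_le_of_le_one_left (norm_nonneg _) hf))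
      rw [map_add] at h2
      simp only [Set.mem_ofPred_eq] at hx2 hy2
      linarith
    obtain ⟨x, hx⟩ := CompleteSpace.complete hC
    refine ⟨x, ContinuousLinearMap.ext fun f => ?_⟩
    exact tendsto_nhds_unique ((f.continuous.tendsto x).mono_left hx) (hlF f)
  intro F
  by_cases hF : F = 0
  · exact ⟨0, by rw [map_zero, hF]⟩
  have hF' : ‖F‖ ≠ 0 := (norm_ne_zero_iff (a := F)).2 hF
  obtain ⟨x, hx⟩ := key (‖F‖⁻¹ • F) (norm_inv_norm_smul F hF)
  exact ⟨‖F‖ • x, by rw [map_smul, hx]; exact smul_inv_smul₀ hF' F⟩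

theorem IsReflexive.prod (hX : IsReflexive X) (hY : IsReflexive Y) : IsReflexive (X × Y) := by
  intro F
  obtain ⟨x, hx⟩ := hX (F.comp ((ContinuousLinearMap.compL ℝ (X × Y) X ℝ).flip
    (ContinuousLinearMap.fst ℝ X Y)))
  obtain ⟨y, hy⟩ := hY (F.comp ((ContinuousLinearMap.compL ℝ (X × Y) Y ℝ).flip
    (ContinuousLinearMap.snd ℝ X Y)))
  refine ⟨(x, y), ContinuousLinearMap.ext fun f => ?_⟩
  have h1 := DFunLike.congr_fun hx (f.comp (ContinuousLinearMap.inl ℝ X Y))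
  have h2 := DFunLike.congr_fun hy (f.comp (ContinuousLinearMap.inr ℝ X Y))
  simp only [NormedSpace.dual_def, ContinuousLinearMap.comp_apply, ContinuousLinearMap.flip_apply,
    ContinuousLinearMap.compL_apply] at h1 h2 ⊢
  have hf : f = (f.comp (ContinuousLinearMap.inl ℝ X Y)).comp (ContinuousLinearMap.fst ℝ X Y)
      + (f.comp (ContinuousLinearMap.inr ℝ X Y)).comp (ContinuousLinearMap.snd ℝ X Y) := by
    ext z <;> simp [← Prod.zero_eq_mk]
  rw [hf, map_add, ← h1, ← h2, ← hf, ← map_add]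
  simp

/-- A complete space that embeds linearly and bi-Lipschitz into a reflexive one is reflexive. -/
theorem IsReflexive.of_antilipschitz [CompleteSpace X] [CompleteSpace Y]
    (hY : IsReflexive Y) (T : X →L[ℝ] Y) {K : NNReal} (hT : AntilipschitzWith K T) :
    IsReflexive X := by
  have hcl : IsClosed (Set.range T) := hT.isClosed_range T.uniformContinuous
  intro F
  obtain ⟨y, hy⟩ := hY (F.comp ((ContinuousLinearMap.compL ℝ X Y ℝ).flip T))
  have hy' : ∀ f : StrongDual ℝ Y, f y = F (f.comp T) := fun f => DFunLike.congr_fun hy f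
  obtain ⟨x, rfl⟩ : y ∈ Set.range T := by
    by_contra hn
    obtain ⟨f, c, hf, hfc⟩ := geometric_hahn_banach_closed_point
      (s := Set.range T) (LinearMap.range T.toLinearMap).convex hcl hn
    -- a functional bounded above on a subspace vanishes on it
    have h0 : f.comp T = 0 := by
      ext x
      by_contra hne
      have := hf (T (((c + 1) / f (T x)) • x)) ⟨_, rfl⟩
      have hne' : f (T x) ≠ 0 := hne
      rw [map_smul, map_smul, smul_eq_mul, div_mul_cancel₀ _ hne'] at this
      linarith
    have h1 := hf 0 ⟨0, map_zero T⟩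
    have h2 := hy' f
    rw [h0, map_zero] at h2
    rw [map_zero] at h1
    linarith
  refine ⟨x, ContinuousLinearMap.ext fun g => ?_⟩
  let e : X ≃L[ℝ] T.toLinearMap.range := ContinuousLinearMap.equivRange hT.injective hcl
  obtain ⟨f, hf, -⟩ := exists_extension_norm_eq _ (g.comp (e.symm : T.toLinearMap.range →L[ℝ] X))
  have hfT : f.comp T = g := by
    ext z
    have := hf (e z)
    rwa [ContinuousLinearMap.comp_apply, ContinuousLinearEquiv.coe_coe,
      e.symm_apply_apply] at this
  rw [NormedSpace.dual_def, ← hfT, ← hy', ContinuousLinearMap.comp_apply]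

end Reflexive

/-! ### Uniform convexity of powers, uniformly in the exponent -/

section Power

variable {F : Type*} [NormedAddCommGroup F] [NormedSpace ℝ F]

theorem norm_midpoint_rpow_lt [StrictConvexSpace ℝ F] {r : ℝ} (hr : 1 < r) {a b : F}
    (hab : a ≠ b) : ‖(1 / 2 : ℝ) • (a + b)‖ ^ r < 1 / 2 * (‖a‖ ^ r + ‖b‖ ^ r) := by
  have hr0 : 0 < r := by linarith
  have hn : ‖(1 / 2 : ℝ) • (a + b)‖ = 1 / 2 * ‖a + b‖ := by
    rw [norm_smul, Real.norm_of_nonneg (by norm_num)]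
  have htri : 1 / 2 * ‖a + b‖ ≤ 1 / 2 * ‖a‖ + 1 / 2 * ‖b‖ := by linarith [norm_add_le a b]
  rw [hn, mul_add]
  by_cases h : ‖a‖ = ‖b‖
  · have hlt : ‖a + b‖ < ‖a‖ + ‖b‖ := lt_of_le_of_ne (norm_add_le a b)
      fun he => hab (eq_of_norm_eq_of_norm_add_eq h he)
    calc (1 / 2 * ‖a + b‖) ^ r < ‖a‖ ^ r :=
          Real.rpow_lt_rpow (by positivity) (by rw [h] at hlt ⊢; linarith) hr0
      _ = 1 / 2 * ‖a‖ ^ r + 1 / 2 * ‖b‖ ^ r := by rw [← h]; ring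
  · refine (Real.rpow_le_rpow (by positivity) htri hr0.le).trans_lt ?_
    simpa using (strictConvexOn_rpow hr).2 (norm_nonneg a) (norm_nonneg b) h
      (by norm_num : (0 : ℝ) < 1 / 2) (by norm_num : (0 : ℝ) < 1 / 2) (by norm_num)

theorem norm_midpoint_rpow_le {r : ℝ} (hr : 1 ≤ r) (a b : F) :
    ‖(1 / 2 : ℝ) • (a + b)‖ ^ r ≤ 1 / 2 * (‖a‖ ^ r + ‖b‖ ^ r) := by
  have hn : ‖(1 / 2 : ℝ) • (a + b)‖ = 1 / 2 * ‖a + b‖ := by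
    rw [norm_smul, Real.norm_of_nonneg (by norm_num)]
  rw [hn, mul_add]
  refine (Real.rpow_le_rpow (by positivity)
    (by linarith [norm_add_le a b] : _ ≤ 1 / 2 * ‖a‖ + 1 / 2 * ‖b‖) (by linarith)).trans ?_
  simpa using (convexOn_rpow hr).2 (norm_nonneg a) (norm_nonneg b)
      (by norm_num : (0 : ℝ) ≤ 1 / 2) (by norm_num : (0 : ℝ) ≤ 1 / 2) (by norm_num)

/-- Up to `ε (‖a‖ ^ r + ‖b‖ ^ r)`, the power `‖a - b‖ ^ r` is controlled by the convexity gap of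
`‖·‖ ^ r`, with a constant `C` that works for all exponents `r ∈ [r₀, r₁]` when `r₀ > 1`. After
normalization this follows from compactness of the set of triples `(r, a, b)`. -/
theorem exists_rpow_norm_sub_le [ProperSpace F] [StrictConvexSpace ℝ F] {r₀ : ℝ} (r₁ : ℝ)
    (h₀ : 1 < r₀) {ε : ℝ} (hε : 0 < ε) :
    ∃ C : ℝ, 0 < C ∧ ∀ r ∈ Set.Icc r₀ r₁, ∀ a b : F,
      ‖a - b‖ ^ r + C * ‖(1 / 2 : ℝ) • (a + b)‖ ^ r ≤ (ε + C / 2) * (‖a‖ ^ r + ‖b‖ ^ r) := by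
  let K : Set (ℝ × F × F) := Set.Icc r₀ r₁ ×ˢ
    ((Metric.closedBall 0 1 ×ˢ Metric.closedBall 0 1) ∩ {z | max ‖z.1‖ ‖z.2‖ = 1})
  let D : ℝ × F × F → ℝ := fun z => ‖z.2.1 - z.2.2‖ ^ z.1 - ε * (‖z.2.1‖ ^ z.1 + ‖z.2.2‖ ^ z.1)
  let G : ℝ × F × F → ℝ := fun z =>
    1 / 2 * (‖z.2.1‖ ^ z.1 + ‖z.2.2‖ ^ z.1) - ‖(1 / 2 : ℝ) • (z.2.1 + z.2.2)‖ ^ z.1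
  have hK : IsCompact K := isCompact_Icc.prod <|
    ((isCompact_closedBall 0 1).prod (isCompact_closedBall 0 1)).inter_right
      (isClosed_eq (by fun_prop) continuous_const)
  have hr : ∀ z ∈ K, 1 < z.1 := fun z hz => h₀.trans_le hz.1.1
  have hpow : ∀ f : ℝ × F × F → F, Continuous f → ContinuousOn (fun z => ‖f z‖ ^ z.1) K :=
    fun f hf => hf.norm.continuousOn.rpow continuousOn_fst
      fun z hz => Or.inr (by linarith [hr z hz])
  have hD : ContinuousOn D K := (hpow (fun z => z.2.1 - z.2.2) (by fun_prop)).sub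
    (continuousOn_const.mul ((hpow (fun z => z.2.1) (by fun_prop)).add
      (hpow (fun z => z.2.2) (by fun_prop))))
  have hG : ContinuousOn G K := (continuousOn_const.mul ((hpow (fun z => z.2.1)
    (by fun_prop)).add (hpow (fun z => z.2.2) (by fun_prop)))).sub
      (hpow (fun z => (1 / 2 : ℝ) • (z.2.1 + z.2.2)) (by fun_prop))
  -- on the diagonal `D < 0`, so on the compact set `{D ≥ 0}` the convexity gap `G` is positive
  let K' : Set (ℝ × F × F) := K ∩ D ⁻¹' Set.Ici 0
  have hK' : IsCompact K' :=
    hK.of_isClosed_subset (hD.preimage_isClosed_of_isClosed hK.isClosed isClosed_Ici)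
      Set.inter_subset_left
  have hGpos : ∀ z ∈ K', 0 < G z := by
    rintro ⟨r, a, b⟩ ⟨hz, hDz⟩
    have h1 : 1 < r := hr _ hz
    refine sub_pos.2 (norm_midpoint_rpow_lt h1 ?_)
    intro hab
    obtain rfl : a = b := hab
    have hmax : ‖a‖ = 1 := by simpa using hz.2.2
    have hDz : 0 ≤ ‖a - a‖ ^ r - ε * (‖a‖ ^ r + ‖a‖ ^ r) := hDz
    rw [sub_self, norm_zero, Real.zero_rpow (by linarith), hmax, Real.one_rpow] at hDz
    linarith
  obtain ⟨C, hC, hCK⟩ : ∃ C : ℝ, 0 < C ∧ ∀ z ∈ K, D z ≤ C * G z := by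
    obtain ⟨M, hM⟩ := (hK'.image_of_continuousOn
      ((hD.mono Set.inter_subset_left).div (hG.mono Set.inter_subset_left)
        fun z hz => (hGpos z hz).ne')).bddAbove
    refine ⟨max M 1, by positivity, fun z hz => ?_⟩
    rcases le_or_gt 0 (D z) with h | h
    · have h1 : D z / G z ≤ max M 1 := (hM ⟨z, ⟨hz, h⟩, rfl⟩).trans (le_max_left _ _)
      exact (div_le_iff₀ (hGpos z ⟨hz, h⟩)).1 h1
    · refine h.le.trans (mul_nonneg (by positivity) ?_)
      exact sub_nonneg.2 (norm_midpoint_rpow_le (hr z hz).le _ _)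
  refine ⟨C, hC, fun r hrI a b => ?_⟩
  have hr1 : 1 < r := h₀.trans_le hrI.1
  -- both sides are homogeneous of degree `r`, which reduces to `max ‖a‖ ‖b‖ = 1`
  rcases (le_max_of_le_left (norm_nonneg a) : 0 ≤ max ‖a‖ ‖b‖).eq_or_lt with hs | hs
  · have ha : a = 0 := norm_le_zero_iff.1 (hs ▸ le_max_left _ _)
    have hb : b = 0 := norm_le_zero_iff.1 (hs ▸ le_max_right _ _)
    simp [ha, hb, Real.zero_rpow (by linarith : r ≠ 0)]
  set s := max ‖a‖ ‖b‖ with hs_def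
  have hscale : ∀ v : F, ‖v‖ ^ r = s ^ r * ‖s⁻¹ • v‖ ^ r := fun v => by
    rw [← Real.mul_rpow hs.le (norm_nonneg _), norm_smul, norm_inv, Real.norm_of_nonneg hs.le,
      mul_inv_cancel_left₀ hs.ne']
  have hnorm : ∀ v : F, ‖s⁻¹ • v‖ = s⁻¹ * ‖v‖ := fun v => by
    rw [norm_smul, norm_inv, Real.norm_of_nonneg hs.le]
  have hmem : (r, s⁻¹ • a, s⁻¹ • b) ∈ K := by
    refine ⟨hrI, ⟨?_, ?_⟩, ?_⟩
    · rw [mem_closedBall_zero_iff, hnorm, inv_mul_le_iff₀ hs, mul_one]; exact le_max_left _ _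
    · rw [mem_closedBall_zero_iff, hnorm, inv_mul_le_iff₀ hs, mul_one]; exact le_max_right _ _
    · change max ‖s⁻¹ • a‖ ‖s⁻¹ • b‖ = 1
      rw [hnorm, hnorm, ← mul_max_of_nonneg _ _ (inv_nonneg.2 hs.le), ← hs_def,
        inv_mul_cancel₀ hs.ne']
  have key := hCK _ hmem
  simp only [D, G] at key
  rw [← smul_sub, ← smul_add, smul_comm] at key
  rw [hscale (a - b), hscale ((1 / 2 : ℝ) • (a + b)), hscale a, hscale b]
  have hsr : 0 ≤ s ^ r := by positivity
  nlinarith [mul_le_mul_of_nonneg_left key hsr]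

end Power

namespace GenPhi

/-! ### Weak lower semicontinuity of convex functions -/

section WeakSemicontinuity

variable {X : Type*} [NormedAddCommGroup X] [NormedSpace ℝ X]

/-- A function whose sublevel sets are convex and norm-closed is weakly lower semicontinuous, by
Mazur's theorem. -/
theorem eventually_lt_of_tendsto_weak {ρ : X → ℝ≥0∞} {c : ℝ≥0∞}
    (hconv : Convex ℝ {x | ρ x ≤ c}) (hclosed : IsClosed {x | ρ x ≤ c}) {u : ℕ → X} {v : X}
    (h : Tendsto (fun n => toWeakSpace ℝ X (u n)) atTop (𝓝 (toWeakSpace ℝ X v)))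
    (hc : c < ρ v) : ∀ᶠ n in atTop, c < ρ (u n) := by
  have hcl : IsClosed (toWeakSpace ℝ X '' {x | ρ x ≤ c}) := by
    rw [← closure_eq_iff_isClosed, ← hconv.toWeakSpace_closure ℝ, hclosed.closure_eq]
  have hv : toWeakSpace ℝ X v ∉ toWeakSpace ℝ X '' {x | ρ x ≤ c} := by
    rintro ⟨w, hw, hwv⟩
    rw [(toWeakSpace ℝ X).injective hwv] at hw
    exact hc.not_ge hw
  filter_upwards [h.eventually (hcl.isOpen_compl.mem_nhds hv)] with n hn
  exact not_le.1 fun hle => hn ⟨u n, hle, rfl⟩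

theorem tendsto_weak_midpoint {u : ℕ → X} {v : X}
    (h : Tendsto (fun n => toWeakSpace ℝ X (u n)) atTop (𝓝 (toWeakSpace ℝ X v))) :
    Tendsto (fun n => toWeakSpace ℝ X ((1 / 2 : ℝ) • (u n + v))) atTop
      (𝓝 (toWeakSpace ℝ X v)) := by
  have h1 := (h.add_const (toWeakSpace ℝ X v)).const_smul (1 / 2 : ℝ)
  rw [← map_add, ← map_smul, ← two_smul ℝ v, smul_smul] at h1
  simpa only [← map_add, ← map_smul, one_div, inv_mul_cancel₀ (two_ne_zero' ℝ), one_smul] using h1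

end WeakSemicontinuity

/-! ### The modular and uniform convexity of the Luxemburg norm -/

section Modular

variable {N : ℕ} {Ω : TopologicalSpace.Opens (EuclideanSpace ℝ (Fin N))} {φ : GenPhi Ω}
  {F : Type*} [NormedAddCommGroup F] [NormedSpace ℝ F]

/-- Power growth of order `r`, a quantitative `Δ₂`-condition: `φ(x, c t) ≤ c^r φ(x, t)` for
`c ≥ 1`. -/
def PowerGrowth (φ : GenPhi Ω) (r : ℝ) : Prop :=
  ∀ᵐ x ∂(volume.restrict (Ω : Set (EuclideanSpace ℝ (Fin N)))), ∀ c t : ℝ, 1 ≤ c → 0 ≤ t →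
    φ.toFun x (c * t) ≤ c ^ r * φ.toFun x t

/-- `φ` grows at least linearly, uniformly in `x`: `t ≤ 1 + φ(x, t)`. -/
def LinearLowerBound (φ : GenPhi Ω) : Prop :=
  ∀ᵐ x ∂(volume.restrict (Ω : Set (EuclideanSpace ℝ (Fin N)))), ∀ t : ℝ, 0 ≤ t →
    t ≤ 1 + φ.toFun x t

/-- A pointwise form of uniform convexity of the modular on `F`-valued functions: up to a small
multiple of `φ(x, |a|) + φ(x, |b|)`, the quantity `φ(x, |a - b|)` is controlled by the convexity gap
`(φ(x, |a|) + φ(x, |b|)) / 2 - φ(x, |(a + b) / 2|)`. -/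
def UniformlyConvexModular (φ : GenPhi Ω) (F : Type*) [NormedAddCommGroup F] [NormedSpace ℝ F] :
    Prop :=
  ∀ ε : ℝ, 0 < ε → ∃ C : ℝ, 0 < C ∧
    ∀ᵐ x ∂(volume.restrict (Ω : Set (EuclideanSpace ℝ (Fin N)))), ∀ a b : F,
      φ.toFun x ‖a - b‖ + C * φ.toFun x ‖(1 / 2 : ℝ) • (a + b)‖
        ≤ (ε + C / 2) * (φ.toFun x ‖a‖ + φ.toFun x ‖b‖)

omit [NormedSpace ℝ F] in
theorem modular_congr_ae {f g : EuclideanSpace ℝ (Fin N) → F}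
    (h : f =ᵐ[volume.restrict (Ω : Set (EuclideanSpace ℝ (Fin N)))] g) :
    φ.modular f = φ.modular g :=
  lintegral_congr_ae (h.mono fun x hx => by simp only [hx])

theorem modular_smul_le {r : ℝ} (hφ : φ.PowerGrowth r) {c : ℝ} (hc : 1 ≤ c)
    (f : EuclideanSpace ℝ (Fin N) → F) :
    φ.modular (fun x => c • f x) ≤ ENNReal.ofReal (c ^ r) * φ.modular f := by
  unfold modular
  rw [← lintegral_const_mul' _ _ ENNReal.ofReal_ne_top]
  refine lintegral_mono_ae (hφ.mono fun x hx => ?_)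
  have hc0 : 0 ≤ c := zero_le_one.trans hc
  rw [← ENNReal.ofReal_mul (by positivity), norm_smul, Real.norm_of_nonneg hc0]
  exact ENNReal.ofReal_le_ofReal (hx c _ hc (norm_nonneg _))

theorem modular_lt_top {r : ℝ} (hφ : φ.PowerGrowth r) (u : φ.space F) : φ.modular u.1 < ∞ := by
  obtain ⟨α, hα, hu⟩ := u.2
  have h1 := (modular_smul_le hφ (le_max_left 1 α⁻¹) (fun x => α • u.1 x)).trans_lt
    (ENNReal.mul_lt_top ENNReal.ofReal_lt_top hu)
  refine (φ.modular_le_mul (a := 1) ((u.1.aestronglyMeasurable.const_smul α).const_smul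
    (max 1 α⁻¹)) zero_le_one le_rfl (Eventually.of_forall fun x => ?_)).trans_lt
    (ENNReal.mul_lt_top ENNReal.ofReal_lt_top h1)
  simp only [Pi.smul_apply, norm_smul, Real.norm_eq_abs, one_mul]
  rw [abs_of_pos hα, abs_of_pos (by positivity), ← mul_assoc]
  refine le_mul_of_one_le_left (norm_nonneg _) ?_
  calc 1 = α⁻¹ * α := (inv_mul_cancel₀ hα.ne').symm
    _ ≤ max 1 α⁻¹ * α := mul_le_mul_of_nonneg_right (le_max_right _ _) hα.le

theorem modular_inv_smul_le_one (u : φ.space F) {τ : ℝ} (h : ‖u‖ < τ) :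
    φ.modular (fun x => τ⁻¹ • u.1 x) ≤ 1 := by
  obtain ⟨σ, hσ, hστ, hu⟩ := exists_lt_of_luxemburg_lt u h
  refine (φ.modular_le_mul (a := 1) (u.1.aestronglyMeasurable.const_smul σ⁻¹)
    zero_le_one le_rfl (Eventually.of_forall fun x => ?_)).trans
    (by rw [ENNReal.ofReal_one, one_mul]; exact hu)
  simp only [Pi.smul_apply, norm_smul, Real.norm_eq_abs, one_mul]
  rw [abs_of_pos (inv_pos.2 hσ), abs_of_pos (inv_pos.2 (hσ.trans hστ))]
  gcongr

theorem modular_le_one {r : ℝ} (hφ : φ.PowerGrowth r) (u : φ.space F) (hu : ‖u‖ ≤ 1) :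
    φ.modular u.1 ≤ 1 := by
  have hlim : Tendsto (fun τ : ℝ => ENNReal.ofReal (τ ^ r)) (𝓝[>] 1) (𝓝 1) := by
    have h1 : Tendsto (fun τ : ℝ => τ ^ r) (𝓝 1) (𝓝 (1 ^ r)) :=
      (Real.continuousAt_rpow_const 1 r (Or.inl one_ne_zero)).tendsto
    rw [Real.one_rpow] at h1
    simpa using ENNReal.tendsto_ofReal (h1.mono_left nhdsWithin_le_nhds)
  refine ge_of_tendsto hlim ?_
  filter_upwards [self_mem_nhdsWithin] with τ hτ
  have hτ : 1 < τ := hτ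
  have h1 := modular_smul_le hφ hτ.le (fun x => τ⁻¹ • u.1 x)
  simp only [smul_inv_smul₀ (zero_lt_one.trans hτ).ne'] at h1
  exact h1.trans (mul_le_of_le_one_right' (modular_inv_smul_le_one u (hu.trans_lt hτ)))

theorem norm_le_of_modular_le {r : ℝ} (hφ : φ.PowerGrowth r) {u : φ.space F} {t : ℝ} (ht : 0 < t)
    (ht1 : t ≤ 1) (h : φ.modular u.1 ≤ ENNReal.ofReal (t ^ r)) : ‖u‖ ≤ t := by
  refine luxemburg_le ht ((modular_smul_le hφ ((one_le_inv₀ ht).2 ht1) u.1).trans ?_)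
  refine (mul_le_mul_right h _).trans ?_
  rw [← ENNReal.ofReal_mul (by positivity), ← Real.mul_rpow (by positivity) ht.le,
    inv_mul_cancel₀ ht.ne', Real.one_rpow, ENNReal.ofReal_one]

/-- The modular is lower semicontinuous with respect to a.e. convergence, by Fatou's lemma. -/
theorem modular_le_of_ae_tendsto {f : ℕ → EuclideanSpace ℝ (Fin N) → F}
    {g : EuclideanSpace ℝ (Fin N) → F} {c : ℝ≥0∞}
    (hf : ∀ n, AEStronglyMeasurable (f n) (volume.restrict (Ω : Set (EuclideanSpace ℝ (Fin N)))))
    (hlim : ∀ᵐ x ∂(volume.restrict (Ω : Set (EuclideanSpace ℝ (Fin N)))),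
      Tendsto (fun n => f n x) atTop (𝓝 (g x)))
    (hc : ∀ᶠ n in atTop, φ.modular (f n) ≤ c) : φ.modular g ≤ c := by
  have h1 : φ.modular g = ∫⁻ x in (Ω : Set (EuclideanSpace ℝ (Fin N))),
      liminf (fun n => ENNReal.ofReal (φ.toFun x ‖f n x‖)) atTop := by
    refine lintegral_congr_ae ?_
    filter_upwards [hlim, φ.ae_isPhi] with x hx hp
    have h2 : Tendsto (fun n => ‖f n x‖) atTop (𝓝[Set.Ici 0] ‖g x‖) :=
      tendsto_nhdsWithin_iff.2 ⟨hx.norm, Eventually.of_forall fun n => norm_nonneg _⟩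
    exact (ENNReal.tendsto_ofReal
      ((hp.continuousOn ‖g x‖ (norm_nonneg _)).tendsto.comp h2)).liminf_eq.symm
  rw [h1]
  exact (lintegral_liminf_le' fun n => (φ.aemeasurable_comp (hf n)).ennreal_ofReal).trans
    (liminf_le_of_frequently_le' hc.frequently)

/-- The integrated form of the inequality in `UniformlyConvexModular`. -/
theorem modular_sub_le {ε C : ℝ} (hε : 0 < ε) (hC : 0 < C)
    (h : ∀ᵐ x ∂(volume.restrict (Ω : Set (EuclideanSpace ℝ (Fin N)))), ∀ a b : F,
      φ.toFun x ‖a - b‖ + C * φ.toFun x ‖(1 / 2 : ℝ) • (a + b)‖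
        ≤ (ε + C / 2) * (φ.toFun x ‖a‖ + φ.toFun x ‖b‖)) (u v : φ.space F) :
    φ.modular (u - v).1 + ENNReal.ofReal C * φ.modular ((1 / 2 : ℝ) • (u + v)).1
      ≤ ENNReal.ofReal (ε + C / 2) * (φ.modular u.1 + φ.modular v.1) := by
  have mu := (φ.aemeasurable_comp u.1.aestronglyMeasurable).ennreal_ofReal
  have mw := (φ.aemeasurable_comp (u - v).1.aestronglyMeasurable).ennreal_ofReal
  unfold modular
  rw [← lintegral_add_left' mu, ← lintegral_const_mul' _ _ ENNReal.ofReal_ne_top,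
    ← lintegral_const_mul' _ _ ENNReal.ofReal_ne_top, ← lintegral_add_left' mw]
  refine lintegral_mono_ae ?_
  filter_upwards [h, φ.ae_isPhi, AEEqFun.coeFn_sub u.1 v.1, AEEqFun.coeFn_add u.1 v.1,
    AEEqFun.coeFn_smul (1 / 2 : ℝ) (u.1 + v.1)] with x hx hp h1 h2 h3
  simp only [Submodule.coe_sub, Submodule.coe_smul, Submodule.coe_add, h1, h3, h2, Pi.sub_apply,
    Pi.add_apply, Pi.smul_apply]
  rw [← ENNReal.ofReal_mul hC.le, ← ENNReal.ofReal_add (hp.nonneg (norm_nonneg _))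
      (hp.nonneg (norm_nonneg _)), ← ENNReal.ofReal_mul (by positivity),
    ← ENNReal.ofReal_add (hp.nonneg (norm_nonneg _))
      (mul_nonneg hC.le (hp.nonneg (norm_nonneg _)))]
  exact ENNReal.ofReal_le_ofReal (hx _ _)

/-- The real form of `modular_sub_le`; under power growth all modulars on `L^φ` are finite. -/
theorem exists_modular_sub_le {r : ℝ} (hφ : φ.PowerGrowth r) (hc : φ.UniformlyConvexModular F)
    {ε : ℝ} (hε : 0 < ε) : ∃ C : ℝ, 0 < C ∧ ∀ u v : φ.space F,
      (φ.modular (u - v).1).toReal + C * (φ.modular ((1 / 2 : ℝ) • (u + v)).1).toReal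
        ≤ (ε + C / 2) * ((φ.modular u.1).toReal + (φ.modular v.1).toReal) := by
  obtain ⟨C, hC, h⟩ := hc ε hε
  refine ⟨C, hC, fun u v => ?_⟩
  have hfin : ∀ w : φ.space F, φ.modular w.1 ≠ ∞ := fun w => (modular_lt_top hφ w).ne
  have h1 := ENNReal.toReal_mono (ENNReal.mul_ne_top ENNReal.ofReal_ne_top
    (ENNReal.add_ne_top.2 ⟨hfin u, hfin v⟩)) (modular_sub_le hε hC h u v)
  rwa [ENNReal.toReal_add (hfin _) (ENNReal.mul_ne_top ENNReal.ofReal_ne_top (hfin _)),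
    ENNReal.toReal_mul, ENNReal.toReal_mul, ENNReal.toReal_add (hfin _) (hfin _),
    ENNReal.toReal_ofReal hC.le, ENNReal.toReal_ofReal (by positivity)] at h1

/-- The Luxemburg norm is uniformly convex: if `‖u - v‖ ≥ ε` on the unit sphere, then the modular
of `u - v` is bounded below, which by `exists_modular_sub_le` keeps the modular of the midpoint away
from `1`, and power growth turns this into a bound for its norm. -/
theorem uniformConvexSpace_space {r : ℝ} (hr : 0 < r) (hφ : φ.PowerGrowth r)
    (hc : φ.UniformlyConvexModular F) : UniformConvexSpace (φ.space F) := by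
  refine ⟨fun ε hε => ?_⟩
  have hfin : ∀ w : φ.space F, φ.modular w.1 ≠ ∞ := fun w => (modular_lt_top hφ w).ne
  -- a lower bound `η` for the modular of functions of norm at least `ε`
  set t := min ε 1 / 2 with ht_def
  have ht : 0 < t := by positivity
  have htε : t < ε := by have := min_le_left ε 1; linarith
  have ht1 : t ≤ 1 := by have := min_le_right ε 1; linarith
  set η := t ^ r with hη_def
  have hη : 0 < η := by positivity
  obtain ⟨C, hC, h⟩ := exists_modular_sub_le hφ hc (by positivity : 0 < η / 4)
  -- the midpoint has modular at most `1 - η / (2 C)`, hence norm at most `s`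
  set s := (max (1 / 2) (1 - η / (2 * C))) ^ r⁻¹ with hs_def
  have hm0 : 0 < max (1 / 2) (1 - η / (2 * C)) := by positivity
  have hm1 : max (1 / 2) (1 - η / (2 * C)) < 1 :=
    max_lt (by norm_num) (sub_lt_self _ (by positivity))
  have hs : 0 < s := by positivity
  have hs1 : s < 1 := Real.rpow_lt_one hm0.le hm1 (inv_pos.2 hr)
  refine ⟨2 * (1 - s), by linarith, fun u hu v hv huv => ?_⟩
  have hone : ∀ w : φ.space F, ‖w‖ = 1 → (φ.modular w.1).toReal ≤ 1 := fun w hw => by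
    simpa using ENNReal.toReal_mono ENNReal.one_ne_top (modular_le_one hφ w hw.le)
  have hlow : η ≤ (φ.modular (u - v).1).toReal := by
    by_contra! hlt
    have := norm_le_of_modular_le hφ ht ht1
      ((ENNReal.le_ofReal_iff_toReal_le (hfin (u - v)) hη.le).2 hlt.le)
    linarith
  have hmid : ‖(1 / 2 : ℝ) • (u + v)‖ ≤ s := by
    refine norm_le_of_modular_le hφ hs hs1.le
      ((ENNReal.le_ofReal_iff_toReal_le (hfin _) (by positivity)).2 ?_)
    rw [hs_def, Real.rpow_inv_rpow hm0.le hr.ne']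
    refine le_trans ?_ (le_max_right _ _)
    have h1 := h u v
    have h2 : (η / 4 + C / 2) * ((φ.modular u.1).toReal + (φ.modular v.1).toReal)
        ≤ (η / 4 + C / 2) * 2 :=
      mul_le_mul_of_nonneg_left (by linarith [hone u hu, hone v hv]) (by positivity)
    have h3 : C * (φ.modular ((1 / 2 : ℝ) • (u + v)).1).toReal ≤ C * (1 - η / (2 * C)) := by
      have : C * (1 - η / (2 * C)) = C - η / 2 := by field_simp
      linarith
    exact le_of_mul_le_mul_left h3 hC
  rw [norm_smul, Real.norm_of_nonneg (by norm_num)] at hmid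
  linarith

end Modular

/-! ### Embedding into `L^1` and completeness -/

section Embedding

variable {N : ℕ} {Ω : TopologicalSpace.Opens (EuclideanSpace ℝ (Fin N))} {φ : GenPhi Ω}
  {F : Type*} [NormedAddCommGroup F] [NormedSpace ℝ F]

/-- The bound `‖u‖_{L^1} ≤ (|Ω| + 1) ‖u‖_φ`. -/
theorem lintegral_enorm_le (hφ : φ.LinearLowerBound)
    (hΩ : volume (Ω : Set (EuclideanSpace ℝ (Fin N))) ≠ ∞) (u : φ.space F) :
    ∫⁻ x in (Ω : Set (EuclideanSpace ℝ (Fin N))), ‖u.1 x‖ₑ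
      ≤ ENNReal.ofReal (((volume (Ω : Set (EuclideanSpace ℝ (Fin N)))).toReal + 1) * ‖u‖) := by
  set V := (volume (Ω : Set (EuclideanSpace ℝ (Fin N)))).toReal with hV
  have key : ∀ τ : ℝ, ‖u‖ < τ → ∫⁻ x in (Ω : Set (EuclideanSpace ℝ (Fin N))), ‖u.1 x‖ₑ
      ≤ ENNReal.ofReal ((V + 1) * τ) := by
    intro τ hτ
    have hτ0 : 0 < τ := (norm_nonneg u).trans_lt hτ
    calc ∫⁻ x in (Ω : Set (EuclideanSpace ℝ (Fin N))), ‖u.1 x‖ₑ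
        ≤ ∫⁻ x in (Ω : Set (EuclideanSpace ℝ (Fin N))),
          ENNReal.ofReal τ * (1 + ENNReal.ofReal (φ.toFun x ‖τ⁻¹ • u.1 x‖)) := by
          refine lintegral_mono_ae ?_
          filter_upwards [hφ, φ.ae_isPhi] with x hx hp
          rw [← ENNReal.ofReal_one, ← ENNReal.ofReal_add zero_le_one (hp.nonneg (norm_nonneg _)),
            ← ENNReal.ofReal_mul hτ0.le, ← ofReal_norm]
          refine ENNReal.ofReal_le_ofReal ?_
          have h1 := hx ‖τ⁻¹ • u.1 x‖ (norm_nonneg _)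
          have h2 : ‖u.1 x‖ = τ * ‖τ⁻¹ • u.1 x‖ := by
            rw [norm_smul, norm_inv, Real.norm_of_nonneg hτ0.le, mul_inv_cancel_left₀ hτ0.ne']
          rw [h2]
          exact mul_le_mul_of_nonneg_left h1 hτ0.le
      _ = ENNReal.ofReal τ * (volume (Ω : Set (EuclideanSpace ℝ (Fin N)))
            + φ.modular (fun x => τ⁻¹ • u.1 x)) := by
          rw [lintegral_const_mul' _ _ ENNReal.ofReal_ne_top, lintegral_add_left measurable_const,
            lintegral_one, Measure.restrict_apply_univ]
          rfl
      _ ≤ ENNReal.ofReal τ * (ENNReal.ofReal V + 1) := by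
          rw [hV, ENNReal.ofReal_toReal hΩ]
          gcongr
          exact modular_inv_smul_le_one u hτ
      _ = ENNReal.ofReal ((V + 1) * τ) := by
          rw [← ENNReal.ofReal_one, ← ENNReal.ofReal_add ENNReal.toReal_nonneg zero_le_one,
            ← ENNReal.ofReal_mul hτ0.le, mul_comm]
  have hlim : Tendsto (fun τ : ℝ => ENNReal.ofReal ((V + 1) * τ)) (𝓝[>] ‖u‖)
      (𝓝 (ENNReal.ofReal ((V + 1) * ‖u‖))) :=
    ENNReal.tendsto_ofReal ((continuous_const_mul (V + 1)).tendsto _ |>.mono_left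
      nhdsWithin_le_nhds)
  refine ge_of_tendsto hlim ?_
  filter_upwards [self_mem_nhdsWithin] with τ hτ using key τ hτ

/-- The continuous inclusion `L^φ(Ω; F) ⊆ L^1(Ω; F)`. -/
noncomputable def toL1 (hφ : φ.LinearLowerBound)
    (hΩ : volume (Ω : Set (EuclideanSpace ℝ (Fin N))) ≠ ∞) :
    φ.space F →L[ℝ] Lp F 1 (volume.restrict (Ω : Set (EuclideanSpace ℝ (Fin N)))) :=
  LinearMap.mkContinuous
    { toFun := fun u => ⟨u.1, Lp.mem_Lp_iff_eLpNorm_lt_top.2 (by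
        rw [eLpNorm_one_eq_lintegral_enorm]
        exact (lintegral_enorm_le hφ hΩ u).trans_lt ENNReal.ofReal_lt_top)⟩
      map_add' := fun _ _ => rfl
      map_smul' := fun _ _ => rfl }
    ((volume (Ω : Set (EuclideanSpace ℝ (Fin N)))).toReal + 1) fun u => by
      rw [Lp.norm_def, eLpNorm_one_eq_lintegral_enorm]
      exact ENNReal.toReal_le_of_le_ofReal (by positivity) (lintegral_enorm_le hφ hΩ u)

theorem exists_seq_tendsto_ae (hφ : φ.LinearLowerBound)
    (hΩ : volume (Ω : Set (EuclideanSpace ℝ (Fin N))) ≠ ∞) {u : ℕ → φ.space F} {v : φ.space F}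
    (h : Tendsto u atTop (𝓝 v)) : ∃ ns : ℕ → ℕ, StrictMono ns ∧
      ∀ᵐ x ∂(volume.restrict (Ω : Set (EuclideanSpace ℝ (Fin N)))),
        Tendsto (fun i => (u (ns i)).1 x) atTop (𝓝 (v.1 x)) :=
  (tendstoInMeasure_of_tendsto_Lp
    (((toL1 hφ hΩ).continuous.tendsto v).comp h)).exists_seq_tendsto_ae

theorem completeSpace_space [CompleteSpace F] (hφ : φ.LinearLowerBound)
    (hΩ : volume (Ω : Set (EuclideanSpace ℝ (Fin N))) ≠ ∞) : CompleteSpace (φ.space F) := by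
  refine Metric.complete_of_cauchySeq_tendsto fun u hu => ?_
  obtain ⟨v, hv⟩ := cauchySeq_tendsto_of_complete
    ((toL1 (F := F) hφ hΩ).uniformContinuous.comp_cauchySeq hu)
  obtain ⟨ns, hns, hlim⟩ := (tendstoInMeasure_of_tendsto_Lp hv).exists_seq_tendsto_ae
  have hlim : ∀ᵐ x ∂(volume.restrict (Ω : Set (EuclideanSpace ℝ (Fin N)))),
      Tendsto (fun i => (u (ns i)).1 x) atTop (𝓝 (v.1 x)) := hlim
  -- Fatou's lemma transfers the Cauchy property to the a.e. limit
  have key : ∀ ε : ℝ, 0 < ε → ∃ n₀, ∀ n ≥ n₀,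
      φ.modular (fun x => ε⁻¹ • ((u n).1 - v.1) x) ≤ 1 := by
    intro ε hε
    obtain ⟨n₀, hn₀⟩ := Metric.cauchySeq_iff.1 hu ε hε
    refine ⟨n₀, fun n hn => ?_⟩
    have hcongr : ∀ w : EuclideanSpace ℝ (Fin N)
        →ₘ[volume.restrict (Ω : Set (EuclideanSpace ℝ (Fin N)))] F,
        φ.modular (fun x => ε⁻¹ • ((u n).1 - w) x)
          = φ.modular (fun x => ε⁻¹ • ((u n).1 x - w x)) := fun w => modular_congr_ae
      ((AEEqFun.coeFn_sub (u n).1 w).mono fun x hx => by simp only [hx, Pi.sub_apply])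
    rw [hcongr]
    refine modular_le_of_ae_tendsto (f := fun i x => ε⁻¹ • ((u n).1 x - (u (ns i)).1 x))
      (fun i => ((u n).1.aestronglyMeasurable.sub (u (ns i)).1.aestronglyMeasurable).const_smul _)
      (hlim.mono fun x hx => (hx.const_sub _).const_smul _) ?_
    filter_upwards [hns.tendsto_atTop.eventually_ge_atTop n₀] with i hi
    rw [← hcongr]
    exact modular_inv_smul_le_one (u n - u (ns i)) (by simpa [dist_eq_norm] using hn₀ n hn _ hi)
  have hmem : v.1 ∈ φ.space F := by
    obtain ⟨n, hn⟩ := key 1 one_pos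
    have h1 : (u n).1 - v.1 ∈ φ.space F :=
      ⟨1⁻¹, by norm_num, (hn n le_rfl).trans_lt ENNReal.one_lt_top⟩
    simpa using sub_mem (u n).2 h1
  refine ⟨⟨v.1, hmem⟩, Metric.tendsto_atTop'.2 fun ε hε => ?_⟩
  obtain ⟨n₀, hn₀⟩ := key (ε / 2) (half_pos hε)
  refine ⟨n₀, fun n hn => ?_⟩
  rw [dist_eq_norm]
  have : ‖u n - ⟨v.1, hmem⟩‖ ≤ ε / 2 := luxemburg_le (half_pos hε) (hn₀ n hn.le)
  linarith

end Embedding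

/-! ### Weak convergence together with convergence of the modular -/

section Weak

variable {N : ℕ} {Ω : TopologicalSpace.Opens (EuclideanSpace ℝ (Fin N))} {φ : GenPhi Ω}
  {F : Type*} [NormedAddCommGroup F] [NormedSpace ℝ F]

theorem convex_modular_le (c : ℝ≥0∞) : Convex ℝ {u : φ.space F | φ.modular u.1 ≤ c} := by
  intro u hu v hv a b ha hb hab
  have hu : φ.modular u.1 ≤ c := hu
  have hv : φ.modular v.1 ≤ c := hv
  refine (φ.modular_le_comb u.1.aestronglyMeasurable v.1.aestronglyMeasurable ha hb hab.le
    ?_).trans ((add_le_add (mul_le_mul_right hu _) (mul_le_mul_right hv _)).trans_eq ?_)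
  · filter_upwards [AEEqFun.coeFn_add (a • u.1) (b • v.1), AEEqFun.coeFn_smul a u.1,
      AEEqFun.coeFn_smul b v.1] with x h1 h2 h3
    simp only [Submodule.coe_add, Submodule.coe_smul, h1, h2, h3, Pi.add_apply, Pi.smul_apply]
    refine (norm_add_le _ _).trans_eq ?_
    rw [norm_smul, norm_smul, Real.norm_of_nonneg ha, Real.norm_of_nonneg hb]
  · rw [← add_mul, ← ENNReal.ofReal_add ha hb, hab, ENNReal.ofReal_one, one_mul]

theorem isClosed_modular_le (hφ : φ.LinearLowerBound)
    (hΩ : volume (Ω : Set (EuclideanSpace ℝ (Fin N))) ≠ ∞) (c : ℝ≥0∞) :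
    IsClosed {u : φ.space F | φ.modular u.1 ≤ c} := by
  refine IsSeqClosed.isClosed fun u v hu huv => ?_
  obtain ⟨ns, -, hlim⟩ := exists_seq_tendsto_ae hφ hΩ huv
  exact modular_le_of_ae_tendsto (fun i => (u (ns i)).1.aestronglyMeasurable) hlim
    (Eventually.of_forall fun i => hu (ns i))

/-- If `u_n ⇀ v` weakly, weak lower semicontinuity bounds the modulars of the midpoints
`(u_n + v) / 2` below by `ρ(v)` in the limit. When also `ρ(u_n) → ρ(v)`, the convexity gap tends to
zero, and `exists_modular_sub_le` gives `ρ(u_n - v) → 0`. -/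
theorem tendsto_of_weak_of_modular {r : ℝ} (hg : φ.PowerGrowth r) (hφ : φ.LinearLowerBound)
    (hc : φ.UniformlyConvexModular F) (hΩ : volume (Ω : Set (EuclideanSpace ℝ (Fin N))) ≠ ∞)
    {u : ℕ → φ.space F} {v : φ.space F}
    (hw : Tendsto (fun n => toWeakSpace ℝ (φ.space F) (u n)) atTop (𝓝 (toWeakSpace ℝ _ v)))
    (hm : Tendsto (fun n => φ.modular (u n).1) atTop (𝓝 (φ.modular v.1))) :
    Tendsto u atTop (𝓝 v) := by
  have hfin : ∀ w : φ.space F, φ.modular w.1 ≠ ∞ := fun w => (modular_lt_top hg w).ne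
  have hmid := tendsto_weak_midpoint hw
  set R := (φ.modular v.1).toReal with hR
  have hR0 : 0 ≤ R := ENNReal.toReal_nonneg
  have hmR : Tendsto (fun n => (φ.modular (u n).1).toReal) atTop (𝓝 R) :=
    (ENNReal.tendsto_toReal (hfin v)).comp hm
  -- `limsup ρ(u_n - v) ≤ 2 ε ρ(v)` for every `ε > 0`
  have key : ∀ η : ℝ, 0 < η → ∀ᶠ n in atTop, (φ.modular (u n - v).1).toReal ≤ η := by
    intro η hη
    set ε := η / (2 * (2 * R + 1)) with hε_def
    have hε : 0 < ε := by positivity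
    have hεη : ε * (2 * R + 1) = η / 2 := by rw [hε_def]; field_simp
    obtain ⟨C, hC, h⟩ := exists_modular_sub_le hg hc hε
    set δ := min 1 (η / (3 * C)) with hδ_def
    have hδ : 0 < δ := by positivity
    have hδ1 : ε * δ ≤ ε * 1 := mul_le_mul_of_nonneg_left (min_le_left _ _) hε.le
    have hδC : C * δ ≤ η / 3 := by
      have := mul_le_mul_of_nonneg_left (min_le_right 1 (η / (3 * C))) hC.le
      rwa [show C * (η / (3 * C)) = η / 3 by field_simp] at this
    have hlow : ∀ᶠ n in atTop, R - δ < (φ.modular ((1 / 2 : ℝ) • (u n + v)).1).toReal := by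
      rcases lt_or_ge (R - δ) 0 with hneg | hpos
      · exact Eventually.of_forall fun n => hneg.trans_le ENNReal.toReal_nonneg
      have hlt : ENNReal.ofReal (R - δ) < φ.modular v.1 :=
        (ENNReal.ofReal_lt_iff_lt_toReal hpos (hfin v)).2 (sub_lt_self _ hδ)
      filter_upwards [eventually_lt_of_tendsto_weak (ρ := fun w : φ.space F => φ.modular w.1)
        (convex_modular_le _) (isClosed_modular_le hφ hΩ _) hmid hlt] with n hn
      exact (ENNReal.ofReal_lt_iff_lt_toReal hpos (hfin _)).1 hn
    filter_upwards [hlow, hmR.eventually (gt_mem_nhds (lt_add_of_pos_right R hδ))] with n h1 h2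
    have h3 := h (u n) v
    rw [← hR] at h3
    have h4 := mul_le_mul_of_nonneg_left h1.le hC.le
    have h5 : (ε + C / 2) * ((φ.modular (u n).1).toReal + R) ≤ (ε + C / 2) * (2 * R + δ) :=
      mul_le_mul_of_nonneg_left (by linarith) (by positivity)
    nlinarith
  refine tendsto_iff_norm_sub_tendsto_zero.2 (Metric.tendsto_nhds.2 fun τ hτ => ?_)
  set t := min τ 1 / 2 with ht_def
  have ht : 0 < t := by positivity
  have htτ : t < τ := by have := min_le_left τ 1; linarith
  have ht1 : t ≤ 1 := by have := min_le_right τ 1; linarith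
  filter_upwards [key (t ^ r) (by positivity)] with n hn
  rw [Real.dist_eq, sub_zero, abs_of_nonneg (norm_nonneg _)]
  exact (norm_le_of_modular_le hg ht ht1
    ((ENNReal.le_ofReal_iff_toReal_le (hfin (u n - v)) (by positivity)).2 hn)).trans_lt htτ

end Weak

end GenPhi

/-! ### Sobolev spaces -/

section Sobolev

variable {N : ℕ} {Ω : TopologicalSpace.Opens (EuclideanSpace ℝ (Fin N))}

theorem tendsto_integral_of_tendsto_L1 {α E G : Type*} [MeasurableSpace α] {ν : Measure α}
    [NormedAddCommGroup E] [NormedAddCommGroup G] [NormedSpace ℝ G] {f : ℕ → Lp E 1 ν}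
    {g : Lp E 1 ν} (h : Tendsto f atTop (𝓝 g)) (B : α → E → G) (M : NNReal)
    (hB : ∀ x, LipschitzWith M (B x)) (hf : ∀ n, Integrable (fun x => B x (f n x)) ν)
    (hg : Integrable (fun x => B x (g x)) ν) :
    Tendsto (fun n => ∫ x, B x (f n x) ∂ν) atTop (𝓝 (∫ x, B x (g x) ∂ν)) := by
  refine tendsto_integral_of_L1 _ hg.1 (Eventually.of_forall hf) ?_
  have h1 : Tendsto (fun n => ∫⁻ x, ‖f n x - g x‖ₑ ∂ν) atTop (𝓝 0) := by
    simpa only [eLpNorm_one_eq_lintegral_enorm, Pi.sub_apply] using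
      (Lp.tendsto_Lp_iff_tendsto_eLpNorm' f g).1 h
  have h2 : Tendsto (fun n => (M : ℝ≥0∞) * ∫⁻ x, ‖f n x - g x‖ₑ ∂ν) atTop (𝓝 0) := by
    simpa using ENNReal.Tendsto.const_mul h1 (Or.inr ENNReal.coe_ne_top)
  refine tendsto_of_tendsto_of_tendsto_of_le_of_le tendsto_const_nhds h2 (fun _ => zero_le)
    fun n => ?_
  simp only
  rw [← lintegral_const_mul' _ _ ENNReal.coe_ne_top]
  refine lintegral_mono fun x => ?_
  rw [← edist_eq_enorm_sub, ← edist_eq_enorm_sub]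
  exact hB x _ _

/-- The relation `g = ∇u` is closed under convergence in `L^1(Ω)`. -/
theorem IsWeakGradient.of_tendsto_L1
    {u : ℕ → Lp ℝ 1 (volume.restrict (Ω : Set (EuclideanSpace ℝ (Fin N))))}
    {g : ℕ → Lp (EuclideanSpace ℝ (Fin N)) 1
      (volume.restrict (Ω : Set (EuclideanSpace ℝ (Fin N))))}
    {u₀ : Lp ℝ 1 (volume.restrict (Ω : Set (EuclideanSpace ℝ (Fin N))))}
    {g₀ : Lp (EuclideanSpace ℝ (Fin N)) 1
      (volume.restrict (Ω : Set (EuclideanSpace ℝ (Fin N))))}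
    (hu : Tendsto u atTop (𝓝 u₀)) (hg : Tendsto g atTop (𝓝 g₀))
    (h : ∀ n, IsWeakGradient Ω (u n) (g n)) : IsWeakGradient Ω u₀ g₀ := by
  have hu₀ : LocallyIntegrableOn u₀ (Ω : Set (EuclideanSpace ℝ (Fin N))) :=
    IntegrableOn.locallyIntegrableOn (L1.integrable_coeFn u₀)
  have hg₀ : LocallyIntegrableOn g₀ (Ω : Set (EuclideanSpace ℝ (Fin N))) :=
    IntegrableOn.locallyIntegrableOn (L1.integrable_coeFn g₀)
  refine ⟨hu₀, hg₀, fun ψ => ?_⟩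
  obtain ⟨M, hM⟩ : ∃ M : NNReal, ∀ x, ‖ψ x‖ ≤ M := by
    obtain ⟨M, hM⟩ := ψ.continuous.bounded_above_of_compact_support ψ.hasCompactSupport
    exact ⟨M.toNNReal, fun x => (hM x).trans (Real.le_coe_toNNReal M)⟩
  obtain ⟨M', hM'⟩ : ∃ M : NNReal, ∀ x, ‖gradient ψ x‖ ≤ M := by
    obtain ⟨M, hM⟩ := (ψ.contDiff.continuous_fderiv (by simp)).bounded_above_of_compact_support
      (ψ.hasCompactSupport.fderiv ℝ)
    refine ⟨M.toNNReal, fun x => ?_⟩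
    rw [gradient, LinearIsometryEquiv.norm_map]
    exact (hM x).trans (Real.le_coe_toNNReal M)
  have h1 := tendsto_integral_of_tendsto_L1 hu (fun x a => a • gradient ψ x) M'
    (fun x => LipschitzWith.of_dist_le_mul fun a b => by
      rw [dist_eq_norm, dist_eq_norm, ← sub_smul, norm_smul, mul_comm]
      exact mul_le_mul_of_nonneg_right (hM' x) (norm_nonneg _))
    (fun n => integrable_smul_grad_test (h n).locallyIntegrableOn ψ)
    (integrable_smul_grad_test hu₀ ψ)
  have h2 := tendsto_integral_of_tendsto_L1 hg (fun x a => ψ x • a) M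
    (fun x => LipschitzWith.of_dist_le_mul fun a b => by
      rw [dist_eq_norm, dist_eq_norm, ← smul_sub, norm_smul]
      exact mul_le_mul_of_nonneg_right (hM x) (norm_nonneg _))
    (fun n => integrable_test_smul (h n).locallyIntegrableOn_grad ψ)
    (integrable_test_smul hg₀ ψ)
  exact tendsto_nhds_unique (h1.congr fun n => (h n).integral_eq ψ) h2.neg

namespace GenPhi

variable {φ : GenPhi Ω}

variable (φ) in
/-- The embedding `u ↦ (u, ∇u)` of `W^{1,φ}(Ω)` into `L^φ(Ω) × L^φ(Ω; ℝ^N)`. -/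
noncomputable def sobolevEmbedding :
    φ.sobolev →L[ℝ] φ.space ℝ × φ.space (EuclideanSpace ℝ (Fin N)) :=
  LinearMap.mkContinuous
    { toFun := fun u => (sobolevVal u, weakGrad u)
      map_add' := fun u v => Prod.ext rfl (weakGrad_add u v)
      map_smul' := fun c u => Prod.ext rfl (weakGrad_smul c u) } 1 fun u => by
    rw [one_mul, norm_sobolev_def]
    exact max_le (le_add_of_nonneg_right (norm_nonneg _)) (le_add_of_nonneg_left (norm_nonneg _))

theorem antilipschitz_sobolevEmbedding : AntilipschitzWith 2 φ.sobolevEmbedding :=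
  AddMonoidHomClass.antilipschitz_of_bound _ fun u => by
    have h1 : ‖sobolevVal u‖ ≤ ‖φ.sobolevEmbedding u‖ := norm_fst_le (φ.sobolevEmbedding u)
    have h2 : ‖weakGrad u‖ ≤ ‖φ.sobolevEmbedding u‖ := norm_snd_le (φ.sobolevEmbedding u)
    rw [norm_sobolev_def, NNReal.coe_ofNat]
    linarith

theorem completeSpace_sobolev (hφ : φ.LinearLowerBound)
    (hΩ : volume (Ω : Set (EuclideanSpace ℝ (Fin N))) ≠ ∞) : CompleteSpace φ.sobolev := by
  have c1 : CompleteSpace (φ.space ℝ) := completeSpace_space hφ hΩ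
  have c2 : CompleteSpace (φ.space (EuclideanSpace ℝ (Fin N))) := completeSpace_space hφ hΩ
  refine Metric.complete_of_cauchySeq_tendsto fun u hu => ?_
  obtain ⟨⟨v, g⟩, hvg⟩ := cauchySeq_tendsto_of_complete
    (φ.sobolevEmbedding.uniformContinuous.comp_cauchySeq hu)
  have hv : Tendsto (fun n => sobolevVal (u n)) atTop (𝓝 v) :=
    (continuous_fst.tendsto (v, g)).comp hvg
  have hg : Tendsto (fun n => weakGrad (u n)) atTop (𝓝 g) :=
    (continuous_snd.tendsto (v, g)).comp hvg
  have hweak : IsWeakGradient Ω v.1 g.1 := IsWeakGradient.of_tendsto_L1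
    (((toL1 hφ hΩ).continuous.tendsto v).comp hv) (((toL1 hφ hΩ).continuous.tendsto g).comp hg)
    fun n => isWeakGradient_weakGrad (u n)
  let w : φ.sobolev := ⟨v.1, v.2, g.1, g.2, hweak⟩
  have hw : φ.sobolevEmbedding w = (v, g) := Prod.ext rfl (weakGrad_eq w g hweak)
  refine ⟨w, ?_⟩
  rw [← hw] at hvg
  exact (antilipschitz_sobolevEmbedding.isInducing
    φ.sobolevEmbedding.continuous).tendsto_nhds_iff.2 hvg

end GenPhi

end Sobolev

/-! ### The double phase function -/

section DoublePhaseFunction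

variable {N : ℕ} {Ω : TopologicalSpace.Opens (EuclideanSpace ℝ (Fin N))}
  {p q μ : EuclideanSpace ℝ (Fin N) → ℝ}

/-- By compactness of the closure of `Ω`, the exponents stay in an interval `[r₀, r₁]` with
`r₀ > 1`. -/
theorem Hypotheses.exists_exponent_bounds (h : Hypotheses Ω p q μ) :
    ∃ r₀ r₁ : ℝ, 1 < r₀ ∧ ∀ x ∈ Ω, p x ∈ Set.Icc r₀ r₁ ∧ q x ∈ Set.Icc r₀ r₁ := by
  have hK : IsCompact (closure (Ω : Set (EuclideanSpace ℝ (Fin N)))) :=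
    h.isBounded.isCompact_closure
  have hne : (closure (Ω : Set (EuclideanSpace ℝ (Fin N)))).Nonempty :=
    h.isConnected.nonempty.closure
  obtain ⟨a, ha, hpa⟩ := hK.exists_isMinOn hne h.continuousOn_p
  obtain ⟨b, -, hqb⟩ := hK.exists_isMaxOn hne h.continuousOn_q
  refine ⟨p a, q b, h.one_lt_p a ha, fun x hx => ?_⟩
  have hx := subset_closure hx
  have h1 : p a ≤ p x := hpa hx
  have h2 : q x ≤ q b := hqb hx
  have h3 := h.p_lt_q x hx
  exact ⟨⟨h1, by linarith⟩, ⟨by linarith, h2⟩⟩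

theorem Hypotheses.volume_ne_top (h : Hypotheses Ω p q μ) :
    volume (Ω : Set (EuclideanSpace ℝ (Fin N))) ≠ ∞ :=
  h.isBounded.measure_lt_top.ne

theorem linearLowerBound_doublePhase (h : Hypotheses Ω p q μ) :
    (doublePhase h).LinearLowerBound := by
  filter_upwards [h.weight_nonneg, ae_restrict_mem Ω.isOpen.measurableSet] with x hμ hx t ht
  have hp := h.one_lt_p x (subset_closure hx)
  change t ≤ 1 + (t ^ p x + μ x * t ^ q x)
  have h1 : 0 ≤ μ x * t ^ q x := by positivity
  have h2 : 0 ≤ t ^ p x := by positivity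
  rcases le_total t 1 with h3 | h3
  · linarith
  · linarith [Real.self_le_rpow_of_one_le h3 hp.le]

theorem powerGrowth_doublePhase (h : Hypotheses Ω p q μ) {r₀ r₁ : ℝ}
    (hr : ∀ x ∈ Ω, p x ∈ Set.Icc r₀ r₁ ∧ q x ∈ Set.Icc r₀ r₁) :
    (doublePhase h).PowerGrowth r₁ := by
  filter_upwards [h.weight_nonneg, ae_restrict_mem Ω.isOpen.measurableSet] with x hμ hx c t hc ht
  have hc0 : 0 ≤ c := zero_le_one.trans hc
  change (c * t) ^ p x + μ x * (c * t) ^ q x ≤ c ^ r₁ * (t ^ p x + μ x * t ^ q x)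
  rw [Real.mul_rpow hc0 ht, Real.mul_rpow hc0 ht, mul_add, mul_left_comm (μ x)]
  have h1 := Real.rpow_le_rpow_of_exponent_le hc (hr x hx).1.2
  have h2 := Real.rpow_le_rpow_of_exponent_le hc (hr x hx).2.2
  gcongr

theorem uniformlyConvexModular_doublePhase (h : Hypotheses Ω p q μ) {r₀ r₁ : ℝ} (h₀ : 1 < r₀)
    (hr : ∀ x ∈ Ω, p x ∈ Set.Icc r₀ r₁ ∧ q x ∈ Set.Icc r₀ r₁) (F : Type*) [NormedAddCommGroup F]
    [NormedSpace ℝ F] [ProperSpace F] [StrictConvexSpace ℝ F] :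
    (doublePhase h).UniformlyConvexModular F := by
  intro ε hε
  obtain ⟨C, hC, hCr⟩ := exists_rpow_norm_sub_le (F := F) r₁ h₀ hε
  refine ⟨C, hC, ?_⟩
  filter_upwards [h.weight_nonneg, ae_restrict_mem Ω.isOpen.measurableSet] with x hμ hx a b
  have h1 := hCr _ (hr x hx).1 a b
  have h2 := mul_le_mul_of_nonneg_left (hCr _ (hr x hx).2 a b) hμ
  simp only [doublePhase]
  linarith

end DoublePhaseFunction

end DoublePhase

theorem mainTheorem8 {N : ℕ} (Ω : TopologicalSpace.Opens (EuclideanSpace ℝ (Fin N)))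
    (p q μ : EuclideanSpace ℝ (Fin N) → ℝ) (h : DoublePhase.Hypotheses Ω p q μ) :
    UniformConvexSpace ((DoublePhase.doublePhase h).space ℝ) ∧
    (CompleteSpace ((DoublePhase.doublePhase h).space ℝ) ∧
      DoublePhase.IsReflexive ((DoublePhase.doublePhase h).space ℝ)) ∧
    (CompleteSpace (DoublePhase.doublePhase h).sobolev ∧
      DoublePhase.IsReflexive (DoublePhase.doublePhase h).sobolev) ∧
    (CompleteSpace (DoublePhase.doublePhase h).sobolevZero ∧
      DoublePhase.IsReflexive (DoublePhase.doublePhase h).sobolevZero) ∧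
    ∀ (u : ℕ → (DoublePhase.doublePhase h).space ℝ) (u₀ : (DoublePhase.doublePhase h).space ℝ),
      Tendsto (fun n => toWeakSpace ℝ ((DoublePhase.doublePhase h).space ℝ) (u n)) atTop
        (𝓝 (toWeakSpace ℝ ((DoublePhase.doublePhase h).space ℝ) u₀)) →
      Tendsto (fun n => (DoublePhase.doublePhase h).modular (u n).1) atTop
        (𝓝 ((DoublePhase.doublePhase h).modular u₀.1)) →
      Tendsto u atTop (𝓝 u₀) := by
  obtain ⟨r₀, r₁, h₀, hr⟩ := h.exists_exponent_bounds
  have hr₁ : 0 < r₁ := by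
    obtain ⟨x, hx⟩ := h.isConnected.nonempty
    linarith [(hr x hx).1.1, (hr x hx).1.2]
  have hg := DoublePhase.powerGrowth_doublePhase h hr
  have hl := DoublePhase.linearLowerBound_doublePhase h
  have hΩ := h.volume_ne_top
  have hc := DoublePhase.uniformlyConvexModular_doublePhase h h₀ hr ℝ
  have hcE := DoublePhase.uniformlyConvexModular_doublePhase h h₀ hr (EuclideanSpace ℝ (Fin N))
  have uc := DoublePhase.GenPhi.uniformConvexSpace_space hr₁ hg hc
  have ucE := DoublePhase.GenPhi.uniformConvexSpace_space hr₁ hg hcE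
  have cs := DoublePhase.GenPhi.completeSpace_space (F := ℝ) hl hΩ
  have csE := DoublePhase.GenPhi.completeSpace_space (F := EuclideanSpace ℝ (Fin N)) hl hΩ
  have rf := DoublePhase.isReflexive_of_uniformConvexSpace
    (X := (DoublePhase.doublePhase h).space ℝ)
  have rfE := DoublePhase.isReflexive_of_uniformConvexSpace
    (X := (DoublePhase.doublePhase h).space (EuclideanSpace ℝ (Fin N)))
  have csS := DoublePhase.GenPhi.completeSpace_sobolev hl hΩ
  have rfS := (rf.prod rfE).of_antilipschitz (DoublePhase.doublePhase h).sobolevEmbedding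
    DoublePhase.GenPhi.antilipschitz_sobolevEmbedding
  have csZ : CompleteSpace (DoublePhase.doublePhase h).sobolevZero :=
    (Submodule.isClosed_topologicalClosure _).completeSpace_coe
  have rfZ := rfS.of_antilipschitz (DoublePhase.doublePhase h).sobolevZero.subtypeL
    isometry_subtype_coe.antilipschitz
  exact ⟨uc, ⟨cs, rf⟩, ⟨csS, rfS⟩, ⟨csZ, rfZ⟩, fun u u₀ hw hm =>
    DoublePhase.GenPhi.tendsto_of_weak_of_modular hg hl hc hΩ hw hm⟩
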